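/- **Theorem 4.2.** Let $M\subset\mathbb{R}^n$ be an embedded $C^2$ submanifold (without boundary), with the Riemannian metric induced from $\mathbb{R}^n$ and its Riemannian distance $d$ (the infimum of the lengths of $C^1$ curves in $M$), and suppose that $(M,d)$ is complete. Let $S\subset M$ be closed in $M$ and $x\in S$. Let $T_xM$ be the tangent space of $M$ at $x$, regarded as a linear subspace of $\mathbb{R}^n$, and $N_x=(T_xM)^\perp$ the normal space. Let - $N^P_S(x)$ be the set of all $\xi\in T_xM$ for which there are $\sigma>0$ and a convex neighborhood $U$ of $x$ in $M$ with $\langle \xi,\exp_x^{-1}y\rangle\le\sigma\, d(x,y)^2$ for all $y\in U\cap S$. Here $U\subset M$ is convex if any two of its points are joined by a unique minimizing geodesic of $M$ and this geodesic lies in $U$, and $\exp_x^{-1}y$ is the initial velocity of the minimizing geodesic $[0,1]\to M$ from $x$ to $y$; - $\mathbf{N}^P_S(x)$ be the set of all $\xi\in\mathbb{R}^n$ for which there are $\sigma>0$ and a convex neighborhood $U$ of $x$ in $\mathbb{R}^n$ with $\langle \xi,y-x\rangle\le\sigma\,\|y-x\|^2$ for all $y\in U\cap S$. Then $$\mathbf{N}^P_S(x)=N^P_S(x)\oplus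 N_x ,$$ that is, $\mathbf{N}^P_S(x)=\{v+w : v\in N^P_S(x),\ w\in N_x\}$, and the representation of each element as such a sum $v+w$ is unique. -/

import Mathlib

open Set Filter Topology MeasureTheory
open scoped ENNReal RealInnerProductSpace Pointwise

noncomputable section

namespace EmbeddedGeometry

variable {n : ℕ}

/-- `M` is an embedded `m`-dimensional submanifold (without boundary) of class `C^2` of `ℝⁿ`:
around each of its points a local `C^2` diffeomorphism of `ℝⁿ` flattens `M` onto an
`m`-dimensional linear subspace. -/
def IsC2Submanifold (m : ℕ) (M : Set (EuclideanSpace ℝ (Fin n))) : Prop :=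
  ∀ x ∈ M, ∃ (Φ : OpenPartialHomeomorph (EuclideanSpace ℝ (Fin n)) (EuclideanSpace ℝ (Fin n)))
    (V : Submodule ℝ (EuclideanSpace ℝ (Fin n))),
    x ∈ Φ.source ∧ ContDiffOn ℝ 2 Φ Φ.source ∧ ContDiffOn ℝ 2 Φ.symm Φ.target ∧
    Module.finrank ℝ V = m ∧ Φ '' (Φ.source ∩ M) = Φ.target ∩ (V : Set _)

/-- The tangent space of `M` at `x`: the velocities at time `0` of the curves in `M` that pass
through `x` at time `0`. For a submanifold these velocities already form a linear subspace; the
span only makes the definition a subspace for every set `M`. -/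
def tangentSpace (M : Set (EuclideanSpace ℝ (Fin n))) (x : EuclideanSpace ℝ (Fin n)) :
    Submodule ℝ (EuclideanSpace ℝ (Fin n)) :=
  Submodule.span ℝ {v | ∃ γ : ℝ → EuclideanSpace ℝ (Fin n),
    (∀ᶠ t in 𝓝 0, γ t ∈ M) ∧ γ 0 = x ∧ HasDerivAt γ v 0}

/-- The normal space of `M` at `x`, the orthogonal complement of the tangent space. -/
def normalSpace (M : Set (EuclideanSpace ℝ (Fin n))) (x : EuclideanSpace ℝ (Fin n)) :
    Submodule ℝ (EuclideanSpace ℝ (Fin n)) :=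
  (tangentSpace M x)ᗮ

/-- The velocity at time `t` of a curve with parameter interval `[0, 1]` (one-sided at the two
ends of the interval). -/
def velocity (γ : ℝ → EuclideanSpace ℝ (Fin n)) (t : ℝ) : EuclideanSpace ℝ (Fin n) :=
  derivWithin γ (Icc 0 1) t

/-- The length of a `C^1` curve with parameter interval `[0, 1]`. -/
def curveLength (γ : ℝ → EuclideanSpace ℝ (Fin n)) : ℝ≥0∞ :=
  ∫⁻ t in Icc (0 : ℝ) 1, ‖velocity γ t‖ₑ

/-- The Riemannian distance of `M` with the metric induced from `ℝⁿ`: the infimum of the lengths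
of the `C^1` curves in `M` from `x` to `y` (it is `∞` if there is none). -/
def riemDist (M : Set (EuclideanSpace ℝ (Fin n))) (x y : EuclideanSpace ℝ (Fin n)) : ℝ≥0∞ :=
  ⨅ (γ : ℝ → EuclideanSpace ℝ (Fin n))
    (_ : ContDiffOn ℝ 1 γ (Icc 0 1) ∧ MapsTo γ (Icc 0 1) M ∧ γ 0 = x ∧ γ 1 = y),
    curveLength γ

/-- `M` is complete for its Riemannian distance. -/
def IsCompleteSubmanifold (M : Set (EuclideanSpace ℝ (Fin n))) : Prop :=
  ∀ u : ℕ → EuclideanSpace ℝ (Fin n), (∀ k, u k ∈ M) →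
    (∀ ε : ℝ≥0∞, 0 < ε → ∃ N, ∀ k ≥ N, ∀ l ≥ N, riemDist M (u k) (u l) < ε) →
    ∃ z ∈ M, Tendsto (fun k => riemDist M (u k) z) atTop (𝓝 0)

/-- `γ : [0, 1] → M` is a geodesic of `M`: it is of class `C^2` and the covariant derivative of
its velocity, that is, the tangential component of its second derivative in `ℝⁿ`, vanishes. -/
def IsGeodesic (M : Set (EuclideanSpace ℝ (Fin n))) (γ : ℝ → EuclideanSpace ℝ (Fin n)) : Prop :=
  ContDiffOn ℝ 2 γ (Icc 0 1) ∧ MapsTo γ (Icc 0 1) M ∧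
    ∀ t ∈ Icc (0 : ℝ) 1, derivWithin (velocity γ) (Icc 0 1) t ∈ normalSpace M (γ t)

/-- `γ : [0, 1] → M` is a minimizing geodesic of `M` from `x` to `y`. -/
def IsMinimizingGeodesic (M : Set (EuclideanSpace ℝ (Fin n)))
    (γ : ℝ → EuclideanSpace ℝ (Fin n)) (x y : EuclideanSpace ℝ (Fin n)) : Prop :=
  IsGeodesic M γ ∧ γ 0 = x ∧ γ 1 = y ∧ curveLength γ = riemDist M x y

/-- `U ⊆ M` is (strongly) convex: any two points of `U` are joined by a unique minimizing geodesic
of `M`, and this geodesic stays in `U`. -/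
def IsGeodesicallyConvex (M U : Set (EuclideanSpace ℝ (Fin n))) : Prop :=
  U ⊆ M ∧ ∀ y ∈ U, ∀ z ∈ U, ∃ γ : ℝ → EuclideanSpace ℝ (Fin n),
    IsMinimizingGeodesic M γ y z ∧ MapsTo γ (Icc 0 1) U ∧
    ∀ η : ℝ → EuclideanSpace ℝ (Fin n), IsMinimizingGeodesic M η y z → EqOn η γ (Icc 0 1)

/-- `v = exp_x⁻¹ y`: the vector `v` is the initial velocity of a minimizing geodesic
`γ : [0, 1] → M` from `x` to `y`. If `x` and `y` lie in a convex subset of `M`, there is exactly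
one such `v`. -/
def IsExpInv (M : Set (EuclideanSpace ℝ (Fin n))) (x y v : EuclideanSpace ℝ (Fin n)) : Prop :=
  ∃ γ : ℝ → EuclideanSpace ℝ (Fin n), IsMinimizingGeodesic M γ x y ∧ velocity γ 0 = v

/-- The intrinsic proximal normal cone at `x` of the subset `S` of the Riemannian manifold `M`:
the tangent vectors `ξ` of `M` at `x` with `⟪ξ, exp_x⁻¹ y⟫ ≤ σ d(x, y)²` for all `y ∈ U ∩ S`, for
some `σ > 0` and some convex neighbourhood `U` of `x` in `M`. -/
def proximalNormalCone (M S : Set (EuclideanSpace ℝ (Fin n))) (x : EuclideanSpace ℝ (Fin n)) :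
    Set (EuclideanSpace ℝ (Fin n)) :=
  {ξ | ξ ∈ tangentSpace M x ∧ ∃ σ : ℝ, 0 < σ ∧ ∃ U : Set (EuclideanSpace ℝ (Fin n)),
    IsGeodesicallyConvex M U ∧ U ∈ 𝓝[M] x ∧
    ∀ y ∈ U ∩ S, ∀ v, IsExpInv M x y v → ⟪ξ, v⟫ ≤ σ * (riemDist M x y).toReal ^ 2}

/-- The proximal normal cone at `x` of the subset `S` of `ℝⁿ` (where `exp_x⁻¹ y = y - x`). -/
def euclideanProximalNormalCone (S : Set (EuclideanSpace ℝ (Fin n)))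
    (x : EuclideanSpace ℝ (Fin n)) : Set (EuclideanSpace ℝ (Fin n)) :=
  {ξ | ∃ σ : ℝ, 0 < σ ∧ ∃ U : Set (EuclideanSpace ℝ (Fin n)), Convex ℝ U ∧ U ∈ 𝓝 x ∧
    ∀ y ∈ U ∩ S, ⟪ξ, y - x⟫ ≤ σ * dist x y ^ 2}

end EmbeddedGeometry

end

/-! Both cones are compared to second order at `x`. For `y ∈ M` near `x` let `d` be the Riemannian
distance and `e = exp_x⁻¹ y`. Then `‖y - x‖ ≤ d ≤ K ‖y - x‖`, `‖y - x - e‖ ≤ Λ d²` and `|⟪w, y - x⟫|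
≤ Λ ‖w‖ ‖y - x‖²` for normal `w`. So `⟪v + w, y - x⟫` and `⟪v, e⟫` differ by `O(d²)` for `v` tangent
and `w` normal, and each proximal inequality yields the other with a larger `σ`. The constants bound
the derivatives of a local `C^2` retraction `R` onto `M` (`IsLocalRetraction`).

The intrinsic cone also asks for a geodesically convex neighbourhood, and most of the work goes into
`isGeodesicallyConvex`. As `M` is only `C^2`, the geodesic equation has merely continuous
coefficients, so Picard–Lindelöf does not apply. Geodesics come from the direct method instead:
`exists_minimal_lipschitzWith` gives a curve of least Lipschitz constant, and the first variation
with the du Bois-Reymond lemma makes it `C^2` with normal acceleration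
(`exists_velocity_of_energy_minimizing`). Uniqueness and confinement to a small ball follow from
second-derivative inequalities for `‖η - γ‖²` and `‖γ - x‖²`. -/

namespace EmbeddedGeometry

open scoped NNReal

/-! ### Calculus of Lipschitz curves and the du Bois-Reymond lemma -/

section LipschitzCurves

variable {E : Type*} [NormedAddCommGroup E] [InnerProductSpace ℝ E]

theorem locallyIntegrable_of_bounded {F : Type*} [NormedAddCommGroup F] {u : ℝ → F}
    (hu : StronglyMeasurable u) {C : ℝ} (hC : ∀ t, ‖u t‖ ≤ C) : LocallyIntegrable u :=
  (locallyIntegrable_const C).mono hu.aestronglyMeasurable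
    (Eventually.of_forall fun t => (hC t).trans (le_abs_self C))

theorem intervalIntegrable_of_bounded {F : Type*} [NormedAddCommGroup F] {u : ℝ → F}
    (hu : AEStronglyMeasurable u) {C : ℝ} (hC : ∀ᵐ t, ‖u t‖ ≤ C) (a b : ℝ) :
    IntervalIntegrable u volume a b :=
  (intervalIntegrable_const (c := C)).mono_fun hu.restrict
    (ae_restrict_of_ae (hC.mono fun _ h => h.trans (le_abs_self C)))

theorem lipschitzWith_integral {u : ℝ → E} (hu : StronglyMeasurable u) {C : ℝ≥0}
    (hC : ∀ t, ‖u t‖ ≤ C) : LipschitzWith C (fun t => ∫ s in (0 : ℝ)..t, u s) := by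
  refine LipschitzWith.of_dist_le_mul fun s t => ?_
  have hi := intervalIntegrable_of_bounded hu.aestronglyMeasurable (Eventually.of_forall hC)
  rw [dist_eq_norm, intervalIntegral.integral_interval_sub_left (hi _ _) (hi _ _), Real.dist_eq]
  exact intervalIntegral.norm_integral_le_of_norm_le_const fun x _ => hC x

theorem exists_bound_integral_of_bounded {u : ℝ → E} (hu : StronglyMeasurable u) {C : ℝ}
    (hC : ∀ t, ‖u t‖ ≤ C) (h0 : ∀ t ∉ Icc (0 : ℝ) 1, u t = 0) :
    ∃ B, 0 ≤ B ∧ ∀ t, ‖∫ s in (0 : ℝ)..t, u s‖ ≤ B := by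
  have hi : IntegrableOn u (Icc 0 1) :=
    (locallyIntegrable_of_bounded hu hC).integrableOn_isCompact isCompact_Icc
  have hi' : Integrable u := (integrableOn_iff_integrable_of_support_subset
    (fun t ht => by_contra fun h => ht (h0 t h))).1 hi
  exact ⟨∫ s, ‖u s‖, integral_nonneg fun _ => norm_nonneg _, fun t =>
    (intervalIntegral.norm_integral_le_integral_norm_uIoc (f := u)).trans
      (setIntegral_le_integral hi'.norm (Eventually.of_forall fun _ => norm_nonneg _))⟩

theorem norm_deriv_le_of_lipschitzWith {f : ℝ → E} {C : ℝ≥0} (hf : LipschitzWith C f) (t : ℝ) :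
    ‖deriv f t‖ ≤ C :=
  norm_deriv_le_of_lipschitz hf

/-- The difference of `f` and the primitive of its derivative is Lipschitz, hence absolutely
continuous, and has derivative zero almost everywhere; so it is constant. -/
theorem integral_deriv_eq_sub_of_lipschitzWith [FiniteDimensional ℝ E] {f : ℝ → E} {C : ℝ≥0}
    (hf : LipschitzWith C f) (a b : ℝ) : ∫ t in a..b, deriv f t = f b - f a := by
  have hm : StronglyMeasurable (deriv f) := stronglyMeasurable_deriv f
  have hb := norm_deriv_le_of_lipschitzWith hf
  have hi := intervalIntegrable_of_bounded hm.aestronglyMeasurable (Eventually.of_forall hb)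
  have hI := lipschitzWith_integral hm hb
  have hac : AbsolutelyContinuousOnInterval
      (fun x => f x - ∫ t in (0 : ℝ)..x, deriv f t) a b :=
    (hf.sub hI).lipschitzOnWith.absolutelyContinuousOnInterval
  obtain ⟨c, hc⟩ := hac.const_of_ae_hasDerivAt_zero (by
    filter_upwards [hf.ae_differentiableAt_real,
      LocallyIntegrable.ae_hasDerivAt_integral (locallyIntegrable_of_bounded hm hb)]
      with t h1 h2 _
    have h3 := h1.hasDerivAt.sub (h2 0)
    rw [sub_self] at h3
    exact h3)
  have ha := hc a left_mem_uIcc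
  have hb' := hc b right_mem_uIcc
  rw [← intervalIntegral.integral_interval_sub_left (hi 0 b) (hi 0 a)]
  rw [← hb', sub_eq_sub_iff_add_eq_add] at ha
  rw [sub_eq_sub_iff_add_eq_add, add_comm, ha, add_comm]

theorem norm_sub_le_integral_norm_deriv [FiniteDimensional ℝ E] {f : ℝ → E} {C : ℝ≥0}
    (hf : LipschitzWith C f)
    {s t : ℝ} (hst : s ≤ t) : ‖f t - f s‖ ≤ ∫ r in s..t, ‖deriv f r‖ := by
  rw [← integral_deriv_eq_sub_of_lipschitzWith hf]
  exact intervalIntegral.norm_integral_le_integral_norm hst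

theorem integral_inner_add_inner_eq_sub {f g f' g' : ℝ → E} {C D : ℝ≥0} (hf : LipschitzWith C f)
    (hg : LipschitzWith D g) (hf' : ∀ᵐ t, HasDerivAt f (f' t) t)
    (hg' : ∀ᵐ t, HasDerivAt g (g' t) t) :
    ∫ t in (0 : ℝ)..1, (⟪f' t, g t⟫ + ⟪f t, g' t⟫) = ⟪f 1, g 1⟫ - ⟪f 0, g 0⟫ := by
  obtain ⟨A, hA⟩ := isCompact_uIcc.exists_bound_of_continuousOn (s := uIcc (0 : ℝ) 1)
    hf.continuous.continuousOn
  obtain ⟨B, hB⟩ := isCompact_uIcc.exists_bound_of_continuousOn (s := uIcc (0 : ℝ) 1)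
    hg.continuous.continuousOn
  have hA0 : 0 ≤ A := (norm_nonneg _).trans (hA 0 left_mem_uIcc)
  have hB0 : 0 ≤ B := (norm_nonneg _).trans (hB 0 left_mem_uIcc)
  have hl : LipschitzOnWith (A.toNNReal * D + C * B.toNNReal) (fun t => ⟪f t, g t⟫)
      (uIcc (0 : ℝ) 1) := by
    refine LipschitzOnWith.of_dist_le_mul fun s hs t ht => ?_
    have h1 : ⟪f s, g s⟫ - ⟪f t, g t⟫ = ⟪f s, g s - g t⟫ + ⟪f s - f t, g t⟫ := by
      rw [inner_sub_right, inner_sub_left]; ring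
    have h2 := hf.dist_le_mul s t
    have h3 := hg.dist_le_mul s t
    rw [dist_eq_norm] at h2 h3
    rw [Real.dist_eq, h1]
    push_cast [Real.coe_toNNReal _ hA0, Real.coe_toNNReal _ hB0]
    calc _ ≤ ‖f s‖ * ‖g s - g t‖ + ‖f s - f t‖ * ‖g t‖ :=
          (abs_add_le _ _).trans
            (add_le_add (abs_real_inner_le_norm _ _) (abs_real_inner_le_norm _ _))
      _ ≤ A * (D * dist s t) + (C * dist s t) * B := by
          gcongr
          · exact hA s hs
          · exact hB t ht
      _ = _ := by ring
  rw [← hl.absolutelyContinuousOnInterval.integral_deriv_eq_sub]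
  refine intervalIntegral.integral_congr_ae ?_
  filter_upwards [hf', hg'] with t h1 h2 _
  rw [(h1.inner ℝ h2).deriv, add_comm]

/-- The lemma of du Bois-Reymond, for bounded measurable data. -/
theorem exists_ae_eq_const_add_integral [FiniteDimensional ℝ E] {a b : ℝ → E}
    (ha : StronglyMeasurable a)
    (hb : StronglyMeasurable b) {A B : ℝ≥0} (hA : ∀ t, ‖a t‖ ≤ A) (hB : ∀ t, ‖b t‖ ≤ B)
    (h : ∀ (u : ℝ → E) (C : ℝ≥0), StronglyMeasurable u → (∀ t, ‖u t‖ ≤ C) →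
      (∀ t ∉ Icc (0 : ℝ) 1, u t = 0) → ∫ t in (0 : ℝ)..1, u t = 0 →
      ∫ t in (0 : ℝ)..1, (⟪a t, ∫ s in (0 : ℝ)..t, u s⟫ + ⟪b t, u t⟫) = 0) :
    ∃ c : E, ∀ᵐ t, t ∈ Ioc (0 : ℝ) 1 → b t = c + ∫ s in (0 : ℝ)..t, a s := by
  set H : ℝ → E := fun t => ∫ s in (0 : ℝ)..t, a s with hH
  have hHl : LipschitzWith A H := lipschitzWith_integral ha hA
  have hHm : StronglyMeasurable H := hHl.continuous.stronglyMeasurable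
  set w : ℝ → E := fun t => b t - H t with hw
  have hwm : StronglyMeasurable w := hb.sub hHm
  set c : E := ∫ t in (0 : ℝ)..1, w t with hc
  -- The test function is `b - H` minus its mean `c`. Integration by parts turns the hypothesis into
  -- `∫ ⟪b - H, u⟫ = 0`, and `∫ u = 0` allows `c` to be subtracted, so `∫ ‖u‖² = 0`.
  set u : ℝ → E := (Icc (0 : ℝ) 1).indicator fun t => w t - c with hu
  have hum : StronglyMeasurable u :=
    (hwm.sub stronglyMeasurable_const).indicator measurableSet_Icc
  have hHb : ∀ t ∈ Icc (0 : ℝ) 1, ‖H t‖ ≤ A := by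
    intro t ht
    have := hHl.dist_le_mul t 0
    simp only [hH, intervalIntegral.integral_same, dist_zero_right, Real.norm_eq_abs] at this
    exact this.trans (mul_le_of_le_one_right A.2 (abs_le.2 ⟨by linarith [ht.1], ht.2⟩))
  have hub : ∀ t, ‖u t‖ ≤ (B + A + ‖c‖₊ : ℝ≥0) := by
    intro t
    by_cases ht : t ∈ Icc (0 : ℝ) 1
    · rw [hu, indicator_of_mem ht]
      push_cast
      exact (norm_sub_le _ _).trans (add_le_add_left
        ((norm_sub_le _ _).trans (add_le_add (hB t) (hHb t ht))) _)
    · rw [hu, indicator_of_notMem ht, norm_zero]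
      exact NNReal.coe_nonneg _
  have hui : ∀ t ∈ Ioc (0 : ℝ) 1, u t = w t - c := fun t ht =>
    indicator_of_mem (Ioc_subset_Icc_self ht) _
  have hwi : IntervalIntegrable w volume 0 1 := by
    have hH' : IntervalIntegrable H volume 0 1 := hHl.continuous.intervalIntegrable _ _
    exact (intervalIntegrable_of_bounded hb.aestronglyMeasurable
      (Eventually.of_forall hB) 0 1).sub hH'
  have huz : ∫ t in (0 : ℝ)..1, u t = 0 := by
    have : ∫ t in (0 : ℝ)..1, u t = ∫ t in (0 : ℝ)..1, (w t - c) := by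
      refine intervalIntegral.integral_congr_ae (Eventually.of_forall fun t ht => ?_)
      rw [uIoc_of_le zero_le_one] at ht
      exact hui t ht
    rw [this, intervalIntegral.integral_sub hwi intervalIntegrable_const]
    simp [hc]
  have h0 := h u _ hum hub (fun t ht => indicator_of_notMem ht _) huz
  set U : ℝ → E := fun t => ∫ s in (0 : ℝ)..t, u s with hU
  have hUl := lipschitzWith_integral hum hub
  have hparts := integral_inner_add_inner_eq_sub hHl hUl
    ((LocallyIntegrable.ae_hasDerivAt_integral (locallyIntegrable_of_bounded ha hA)).mono
      fun t ht => ht 0)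
    ((LocallyIntegrable.ae_hasDerivAt_integral (locallyIntegrable_of_bounded hum hub)).mono
      fun t ht => ht 0)
  simp only [huz, intervalIntegral.integral_same, inner_zero_right, sub_zero] at hparts
  have hUc := hUl.continuous
  have inn : ∀ {f g : ℝ → E} {F G : ℝ}, AEStronglyMeasurable f → AEStronglyMeasurable g →
      (∀ t ∈ Ioc (0 : ℝ) 1, ‖f t‖ ≤ F) → (∀ t ∈ Ioc (0 : ℝ) 1, ‖g t‖ ≤ G) →
      IntervalIntegrable (fun t => ⟪f t, g t⟫) volume 0 1 := by
    intro f g F G hf hg hF hG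
    refine (intervalIntegrable_const (c := F * G)).mono_fun (hf.inner hg).restrict ?_
    rw [uIoc_of_le zero_le_one]
    filter_upwards [ae_restrict_mem measurableSet_Ioc] with t ht
    exact (norm_inner_le_norm _ _).trans ((mul_le_mul (hF t ht) (hG t ht) (norm_nonneg _)
      ((norm_nonneg _).trans (hF t ht))).trans (le_abs_self _))
  obtain ⟨G, hG⟩ := (isCompact_Icc (a := (0 : ℝ)) (b := 1)).exists_bound_of_continuousOn
    hUc.continuousOn
  have i1 : IntervalIntegrable (fun t => ⟪a t, U t⟫) volume 0 1 :=
    inn ha.aestronglyMeasurable hUc.aestronglyMeasurable (fun t _ => hA t)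
      (fun t ht => hG t (Ioc_subset_Icc_self ht))
  have i2 : IntervalIntegrable (fun t => ⟪b t, u t⟫) volume 0 1 :=
    inn hb.aestronglyMeasurable hum.aestronglyMeasurable (fun t _ => hB t) (fun t _ => hub t)
  have i3 : IntervalIntegrable (fun t => ⟪H t, u t⟫) volume 0 1 :=
    inn hHm.aestronglyMeasurable hum.aestronglyMeasurable
      (fun t ht => hHb t (Ioc_subset_Icc_self ht)) (fun t _ => hub t)
  have i4 : IntervalIntegrable (fun t => ⟪u t, u t⟫) volume 0 1 :=
    inn hum.aestronglyMeasurable hum.aestronglyMeasurable (fun t _ => hub t) (fun t _ => hub t)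
  have i5 : IntervalIntegrable u volume 0 1 :=
    intervalIntegrable_of_bounded hum.aestronglyMeasurable (Eventually.of_forall hub) _ _
  rw [intervalIntegral.integral_add i1 i2] at h0
  rw [intervalIntegral.integral_add i1 i3] at hparts
  have i6 : IntervalIntegrable (fun t => ⟪c, u t⟫) volume 0 1 :=
    inn aestronglyMeasurable_const hum.aestronglyMeasurable (fun t _ => le_rfl) (fun t _ => hub t)
  have hcz : ∫ t in (0 : ℝ)..1, ⟪c, u t⟫ = 0 := by
    have := (innerSL ℝ c).intervalIntegral_comp_comm i5
    simp only [innerSL_apply_apply] at this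
    rw [this, huz, inner_zero_right]
  have hsq : ∫ t in (0 : ℝ)..1, ⟪u t, u t⟫ = 0 := by
    have : ∫ t in (0 : ℝ)..1, ⟪u t, u t⟫ =
        ∫ t in (0 : ℝ)..1, (⟪b t, u t⟫ - ⟪H t, u t⟫ - ⟪c, u t⟫) := by
      refine intervalIntegral.integral_congr_ae (Eventually.of_forall fun t ht => ?_)
      rw [uIoc_of_le zero_le_one] at ht
      rw [← inner_sub_left, ← inner_sub_left]
      nth_rw 1 [hui t ht]
    rw [this, intervalIntegral.integral_sub (i2.sub i3) i6, intervalIntegral.integral_sub i2 i3,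
      hcz]
    linarith
  rw [intervalIntegral.integral_of_le zero_le_one,
    integral_eq_zero_iff_of_nonneg (fun t => real_inner_self_nonneg)
      ((intervalIntegrable_iff_integrableOn_Ioc_of_le zero_le_one).1 i4)] at hsq
  refine ⟨c, ?_⟩
  have h2 := (ae_restrict_iff' measurableSet_Ioc).1 hsq
  filter_upwards [h2] with t h3 ht
  have h4 : u t = 0 := inner_self_eq_zero.1 (h3 ht)
  rw [hui t ht, sub_eq_zero] at h4
  rw [← h4]
  exact (sub_add_cancel (b t) (H t)).symm

end LipschitzCurves

/-! ### Reparametrization and curves of least Lipschitz constant -/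

section Reparametrization

variable {E : Type*} [NormedAddCommGroup E]

/-- A curve whose increments are bounded by those of a function increasing from `0` to `L` can be
reparametrized to a curve with Lipschitz constant `L`. -/
theorem exists_lipschitzWith_reparametrization {f : ℝ → E} {ℓ : ℝ → ℝ} {M : Set E} {L : ℝ≥0}
    (hf : MapsTo f (Icc 0 1) M) (hℓ : ContinuousOn ℓ (Icc 0 1)) (h0 : ℓ 0 = 0) (h1 : ℓ 1 = L)
    (h : ∀ s ∈ Icc (0 : ℝ) 1, ∀ t ∈ Icc (0 : ℝ) 1, ‖f s - f t‖ ≤ |ℓ s - ℓ t|) :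
    ∃ g : ℝ → E, LipschitzWith L g ∧ (∀ t, g t ∈ M ∧ ‖g t - f 0‖ ≤ L) ∧ g 0 = f 0 ∧ g 1 = f 1 := by
  -- The chosen `σ` need not be continuous: the bound on increments alone makes `f ∘ σ` Lipschitz
  -- and, at the two ends, independent of the choice.
  have hsurj : ∀ u : Icc (0 : ℝ) 1, ∃ t ∈ Icc (0 : ℝ) 1, ℓ t = L * u := by
    intro u
    have := intermediate_value_Icc zero_le_one hℓ
    rw [h0, h1] at this
    obtain ⟨t, ht, h⟩ := this ⟨mul_nonneg L.2 u.2.1, mul_le_of_le_one_right L.2 u.2.2⟩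
    exact ⟨t, ht, h⟩
  choose σ hσ hσℓ using hsurj
  have hl : LipschitzWith L fun u : Icc (0 : ℝ) 1 => f (σ u) := by
    refine LipschitzWith.of_dist_le_mul fun u v => ?_
    rw [dist_eq_norm]
    refine (h _ (hσ u) _ (hσ v)).trans ?_
    rw [hσℓ, hσℓ, ← mul_sub, abs_mul, NNReal.abs_eq, Subtype.dist_eq, Real.dist_eq]
  have hend : ∀ (t : ℝ) (ht : t ∈ Icc (0 : ℝ) 1), ℓ t = L * t → f (σ ⟨t, ht⟩) = f t := by
    intro t ht hL
    have := h _ (hσ ⟨t, ht⟩) t ht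
    rw [hσℓ, hL, sub_self, abs_zero, norm_le_zero_iff, sub_eq_zero] at this
    exact this
  refine ⟨fun t => f (σ (projIcc 0 1 zero_le_one t)), ?_, fun t => ⟨hf (hσ _), ?_⟩, ?_, ?_⟩
  · simpa using! hl.comp (LipschitzWith.projIcc zero_le_one)
  · refine (h _ (hσ _) 0 (left_mem_Icc.2 zero_le_one)).trans ?_
    rw [hσℓ, h0, sub_zero, abs_mul, NNReal.abs_eq, abs_of_nonneg (projIcc 0 1 zero_le_one t).2.1]
    exact mul_le_of_le_one_right L.2 (projIcc 0 1 zero_le_one t).2.2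
  · simp only [projIcc_left]
    exact hend 0 _ (by simp [h0])
  · simp only [projIcc_right]
    exact hend 1 _ (by simp [h1])

/-- Among the Lipschitz curves in a compact part of a set there is one with the least Lipschitz
constant. -/
theorem exists_minimal_lipschitzWith {K : Set E} (hK : IsCompact K) {y z : E} {L₀ : ℝ≥0}
    (hne : ∃ f : ℝ → E, LipschitzWith L₀ f ∧ (∀ t, f t ∈ K) ∧ f 0 = y ∧ f 1 = z) :
    ∃ (L : ℝ≥0) (f : ℝ → E), L ≤ L₀ ∧ LipschitzWith L f ∧ (∀ t, f t ∈ K) ∧ f 0 = y ∧ f 1 = z ∧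
      ∀ (L' : ℝ≥0) (g : ℝ → E), LipschitzWith L' g → (∀ t, g t ∈ K) → g 0 = y → g 1 = z →
        L ≤ L' := by
  set A : ℝ≥0 → Set (ℝ → E) := fun L => {f | LipschitzWith L f ∧ (∀ t, f t ∈ K) ∧ f 0 = y ∧ f 1 = z}
    with hA
  have hcl : ∀ L, IsClosed (A L) := by
    intro L
    have e1 : IsClosed {f : ℝ → E | LipschitzWith L f} := by
      simp only [lipschitzWith_iff_dist_le_mul, ofPred_forall]
      exact isClosed_iInter fun s => isClosed_iInter fun t =>
        isClosed_le ((continuous_apply s).dist (continuous_apply t)) continuous_const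
    have e2 : IsClosed {f : ℝ → E | ∀ t, f t ∈ K} := by
      simp only [ofPred_forall]
      exact isClosed_iInter fun t => hK.isClosed.preimage (continuous_apply t)
    exact e1.inter (e2.inter ((isClosed_eq (continuous_apply 0) continuous_const).inter
      (isClosed_eq (continuous_apply 1) continuous_const)))
  -- All conditions are pointwise and closed, so Tychonoff's theorem gives compactness in the
  -- product topology. The sets `A L` are nested, hence the nonempty ones share a curve, and that
  -- curve realizes the infimum.
  have hcp : ∀ L, IsCompact (A L) := fun L =>
    (isCompact_univ_pi fun _ : ℝ => hK).of_isClosed_subset (hcl L) fun f hf t _ => hf.2.1 t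
  have hmono : ∀ {L L'}, L ≤ L' → A L ⊆ A L' := fun hL f hf => ⟨hf.1.weaken hL, hf.2⟩
  set T : Set ℝ≥0 := {L | (A L).Nonempty} with hT
  have hTne : T.Nonempty := ⟨L₀, hne⟩
  have hne' : (⋂ L : T, A L).Nonempty := by
    have : Nonempty T := hTne.to_subtype
    refine IsCompact.nonempty_iInter_of_directed_nonempty_isCompact_isClosed _ ?_
      (fun L => L.2) (fun L => hcp L) (fun L => hcl L)
    intro L L'
    rcases le_total L.1 L'.1 with h | h
    · exact ⟨L, subset_rfl, hmono h⟩
    · exact ⟨L', hmono h, subset_rfl⟩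
  obtain ⟨f, hf⟩ := hne'
  rw [mem_iInter] at hf
  have hfl : LipschitzWith (sInf T) f := by
    refine LipschitzWith.of_dist_le_mul fun s t => ?_
    rcases eq_or_ne s t with rfl | hst
    · simp
    have hd : 0 < nndist s t := pos_iff_ne_zero.2 (nndist_eq_zero.not.2 hst)
    have h : nndist (f s) (f t) / nndist s t ≤ sInf T := le_csInf hTne fun L hL =>
      (div_le_iff₀ hd).2 ((hf ⟨L, hL⟩).1.dist_le_mul s t)
    exact NNReal.coe_le_coe.2 ((div_le_iff₀ hd).1 h)
  have h0 := hf ⟨L₀, hne⟩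
  refine ⟨sInf T, f, csInf_le' hne, hfl, h0.2.1, h0.2.2.1, h0.2.2.2, fun L' g h1 h2 h3 h4 => ?_⟩
  exact csInf_le' ⟨g, h1, h2, h3, h4⟩

end Reparametrization

/-! ### First variation of the energy and regularity of minimizers -/

section Regularity

variable {E : Type*} [NormedAddCommGroup E] [InnerProductSpace ℝ E] [FiniteDimensional ℝ E]

/-- The quadratic form of this operator is `‖T v‖² + ‖v - T v‖²`, which vanishes only at `v = 0`. -/
theorem isUnit_adjoint_mul_add (T : E →L[ℝ] E) :
    IsUnit (ContinuousLinearMap.adjoint T * T +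
      ContinuousLinearMap.adjoint (1 - T) * (1 - T)) := by
  set S := ContinuousLinearMap.adjoint T * T + ContinuousLinearMap.adjoint (1 - T) * (1 - T)
    with hS
  have hinner : ∀ v, ⟪S v, v⟫ = ‖T v‖ ^ 2 + ‖v - T v‖ ^ 2 := by
    intro v
    simp only [hS, add_apply, mul_apply_eq_comp, inner_add_left,
      ContinuousLinearMap.adjoint_inner_left, real_inner_self_eq_norm_sq,
      sub_apply, one_apply_eq_self]
  have hinj : Function.Injective S.toLinearMap := by
    rw [← LinearMap.ker_eq_bot, LinearMap.ker_eq_bot']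
    intro v hv
    have h := hinner v
    have hv' : S v = 0 := hv
    rw [hv', inner_zero_left] at h
    have h1 : ‖T v‖ = 0 := by nlinarith [norm_nonneg (T v), sq_nonneg ‖v - T v‖]
    have h2 : ‖v - T v‖ = 0 := by nlinarith [norm_nonneg (v - T v), sq_nonneg ‖T v‖]
    rw [norm_eq_zero] at h1 h2
    rw [h1, sub_zero] at h2
    exact h2
  exact ContinuousLinearMap.isUnit_iff_bijective.2
    ⟨hinj, LinearMap.injective_iff_surjective.1 hinj⟩

/-- A vector fixed by an operator `T` can be recovered from its image under the adjoint of `T`, in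
a way which depends smoothly on `T`. -/
theorem exists_contDiff_leftInverse_adjoint :
    ∃ Θ : (E →L[ℝ] E) → E →L[ℝ] E, ContDiff ℝ 1 Θ ∧
      ∀ T v, T v = v → Θ T (ContinuousLinearMap.adjoint T v) = v := by
  let adj : (E →L[ℝ] E) →L[ℝ] (E →L[ℝ] E) := LinearMap.toContinuousLinearMap
    { toFun := fun T => ContinuousLinearMap.adjoint T
      map_add' := fun S T => map_add _ S T
      map_smul' := fun c T => by simp }
  have hadj : ∀ T, adj T = ContinuousLinearMap.adjoint T := fun T => rfl
  -- If `T v = v`, the second summand kills `v` and the first sends it to the adjoint of `T` applied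
  -- to `v`; the inverse undoes this.
  refine ⟨fun T => Ring.inverse (adj T * T + adj (1 - T) * (1 - T)), ?_, ?_⟩
  · rw [contDiff_iff_contDiffAt]
    intro T
    obtain ⟨S, hS⟩ := isUnit_adjoint_mul_add T
    have h1 := contDiffAt_ringInverse ℝ (n := 1) S
    rw [hS] at h1
    have h2 : ContDiff ℝ 1 fun T : E →L[ℝ] E => adj T * T + adj (1 - T) * (1 - T) :=
      (adj.contDiff.mul contDiff_id).add
        ((adj.contDiff.comp (contDiff_const.sub contDiff_id)).mul (contDiff_const.sub contDiff_id))
    exact ContDiffAt.comp T h1 h2.contDiffAt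
  · intro T v hv
    simp only [hadj]
    have h1 : (ContinuousLinearMap.adjoint T * T +
        ContinuousLinearMap.adjoint (1 - T) * (1 - T) : E →L[ℝ] E) v =
          ContinuousLinearMap.adjoint T v := by
      simp [hv]
    rw [← h1, ← mul_apply_eq_comp,
      Ring.inverse_mul_cancel _ (isUnit_adjoint_mul_add T)]
    rfl

variable {R : E → E} {γ : ℝ → E} {L : ℝ≥0} {x : E} {ρ : ℝ}

/-- The first variation of the energy along the curves `R (γ + ε X)`, where `X` is a primitive
of `u`. -/
theorem integral_firstVariation_eq_zero (hR : ContDiff ℝ 2 R) (hγ : LipschitzWith L γ)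
    (hγx : ∀ t, γ t ∈ Metric.closedBall x ρ) (hRγ : ∀ t, R (γ t) = γ t)
    {u X : ℝ → E} {C : ℝ≥0} (hu : StronglyMeasurable u) (hC : ∀ t, ‖u t‖ ≤ C)
    (hXu : ∀ᵐ t, HasDerivAt X (u t) t) (hXc : Continuous X) {B : ℝ} (hB : ∀ t, ‖X t‖ ≤ B)
    (hmin : ∀ᶠ ε in 𝓝 (0 : ℝ),
      (L : ℝ) ^ 2 ≤ ∫ t in (0 : ℝ)..1, ‖deriv (fun t => R (γ t + ε • X t)) t‖ ^ 2) :
    ∫ t in (0 : ℝ)..1, ⟪deriv γ t,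
      fderiv ℝ (fderiv ℝ R) (γ t) (X t) (deriv γ t) + fderiv ℝ R (γ t) (u t)⟫ = 0 := by
  set g := deriv γ with hg
  have hgm : StronglyMeasurable g := stronglyMeasurable_deriv γ
  have hgb : ∀ t, ‖g t‖ ≤ L := norm_deriv_le_of_lipschitzWith hγ
  set Q := fderiv ℝ R with hQ
  have hQ1 : ContDiff ℝ 1 Q := hR.fderiv_right (by norm_num)
  set DQ := fderiv ℝ Q with hDQ
  have hQc : Continuous Q := hQ1.continuous
  have hDQc : Continuous DQ := hQ1.continuous_fderiv one_ne_zero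
  have hB0 : 0 ≤ B := (norm_nonneg _).trans (hB 0)
  have hcpt : IsCompact (Metric.closedBall x (ρ + B)) := isCompact_closedBall _ _
  obtain ⟨K₁, hK₁⟩ := hcpt.exists_bound_of_continuousOn hQc.continuousOn
  obtain ⟨K₂, hK₂⟩ := hcpt.exists_bound_of_continuousOn (f := DQ) hDQc.continuousOn
  have hmem : ∀ ε ∈ Metric.ball (0 : ℝ) 1, ∀ t, γ t + ε • X t ∈ Metric.closedBall x (ρ + B) := by
    intro ε hε t
    have h1 := hγx t
    rw [mem_closedBall_iff_norm] at h1 ⊢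
    have h2 : ‖ε • X t‖ ≤ B := by
      rw [norm_smul]
      rw [mem_ball_zero_iff] at hε
      exact (mul_le_of_le_one_left (norm_nonneg _) hε.le).trans (hB t)
    calc ‖γ t + ε • X t - x‖ = ‖(γ t - x) + ε • X t‖ := by congr 1; abel
      _ ≤ _ := (norm_add_le _ _).trans (add_le_add h1 h2)
  -- By the chain rule `D ε` is almost everywhere the velocity of the varied curve; `D'` is its
  -- derivative in `ε`.
  set D : ℝ → ℝ → E := fun ε t => Q (γ t + ε • X t) (g t + ε • u t) with hD
  set D' : ℝ → ℝ → E := fun ε t => DQ (γ t + ε • X t) (X t) (g t + ε • u t) +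
    Q (γ t + ε • X t) (u t) with hD'
  have hDm : ∀ ε, StronglyMeasurable (D ε) := by
    intro ε
    have h1 : StronglyMeasurable fun t => (γ t + ε • X t, g t + ε • u t) :=
      (hγ.continuous.add (hXc.const_smul ε)).stronglyMeasurable.prodMk
        (hgm.add (hu.const_smul ε))
    have h2 : Continuous fun p : E × E => Q p.1 p.2 :=
      (hQc.comp continuous_fst).clm_apply continuous_snd
    exact h2.comp_stronglyMeasurable h1
  have hD'm : ∀ ε, StronglyMeasurable (D' ε) := by
    intro ε
    have h1 : StronglyMeasurable fun t => (γ t + ε • X t, X t, g t + ε • u t, u t) :=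
      (hγ.continuous.add (hXc.const_smul ε)).stronglyMeasurable.prodMk
        (hXc.stronglyMeasurable.prodMk ((hgm.add (hu.const_smul ε)).prodMk hu))
    have h2 : Continuous fun p : E × E × E × E => DQ p.1 p.2.1 p.2.2.1 + Q p.1 p.2.2.2 := by
      fun_prop
    exact h2.comp_stronglyMeasurable h1
  have hgu : ∀ ε ∈ Metric.ball (0 : ℝ) 1, ∀ t, ‖g t + ε • u t‖ ≤ L + C := by
    intro ε hε t
    refine (norm_add_le _ _).trans (add_le_add (hgb t) ?_)
    rw [norm_smul]
    rw [mem_ball_zero_iff] at hε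
    exact (mul_le_of_le_one_left (norm_nonneg _) hε.le).trans (hC t)
  have hDb : ∀ ε ∈ Metric.ball (0 : ℝ) 1, ∀ t, ‖D ε t‖ ≤ K₁ * (L + C) := fun ε hε t =>
    (ContinuousLinearMap.le_opNorm _ _).trans (mul_le_mul (hK₁ _ (hmem ε hε t)) (hgu ε hε t)
      (norm_nonneg _) ((norm_nonneg _).trans (hK₁ _ (hmem ε hε t))))
  have hD'b : ∀ ε ∈ Metric.ball (0 : ℝ) 1, ∀ t, ‖D' ε t‖ ≤ K₂ * B * (L + C) + K₁ * C := by
    intro ε hε t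
    have k1 := hK₁ _ (hmem ε hε t)
    have k2 := hK₂ _ (hmem ε hε t)
    refine (norm_add_le _ _).trans (add_le_add ?_ ?_)
    · refine (ContinuousLinearMap.le_opNorm _ _).trans (mul_le_mul ?_ (hgu ε hε t)
        (norm_nonneg _) (mul_nonneg ((norm_nonneg _).trans k2) hB0))
      exact (ContinuousLinearMap.le_opNorm _ _).trans (mul_le_mul k2 (hB t) (norm_nonneg _)
        ((norm_nonneg _).trans k2))
    · exact (ContinuousLinearMap.le_opNorm _ _).trans (mul_le_mul k1 (hC t) (norm_nonneg _)
        ((norm_nonneg _).trans k1))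
  have hdiff : ∀ t ε, HasDerivAt (fun ε => D ε t) (D' ε t) ε := by
    intro t ε
    have e1 : HasDerivAt (fun ε : ℝ => γ t + ε • X t) (X t) ε := by
      simpa using ((hasDerivAt_id ε).smul_const (X t)).const_add (γ t)
    have e2 : HasDerivAt (fun ε : ℝ => g t + ε • u t) (u t) ε := by
      simpa using ((hasDerivAt_id ε).smul_const (u t)).const_add (g t)
    have e3 : HasFDerivAt Q (DQ (γ t + ε • X t)) (γ t + ε • X t) :=
      (hQ1.differentiable one_ne_zero _).hasFDerivAt
    have e4 : HasDerivAt (fun ε : ℝ => Q (γ t + ε • X t)) (DQ (γ t + ε • X t) (X t)) ε :=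
      e3.comp_hasDerivAt ε e1
    exact e4.clm_apply e2
  have hnorm : ∀ t ε, HasDerivAt (fun ε => ‖D ε t‖ ^ 2) (2 * ⟪D ε t, D' ε t⟫) ε := fun t ε =>
    (hdiff t ε).norm_sq
  have hball : Metric.ball (0 : ℝ) 1 ∈ 𝓝 (0 : ℝ) := Metric.ball_mem_nhds _ one_pos
  have h0 : (0 : ℝ) ∈ Metric.ball (0 : ℝ) 1 := Metric.mem_ball_self one_pos
  have hmain := (intervalIntegral.hasDerivAt_integral_of_dominated_loc_of_deriv_le
    (μ := volume) (a := 0) (b := 1)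
    (F := fun ε t => ‖D ε t‖ ^ 2) (F' := fun ε t => 2 * ⟪D ε t, D' ε t⟫) (x₀ := (0 : ℝ))
    (bound := fun _ => 2 * (K₁ * (L + C) * (K₂ * B * (L + C) + K₁ * C))) hball
    (Eventually.of_forall fun ε => ((hDm ε).norm.pow 2).aestronglyMeasurable)
    (intervalIntegrable_of_bounded (C := (K₁ * (L + C)) ^ 2)
      ((hDm 0).norm.pow 2).aestronglyMeasurable (Eventually.of_forall fun t => by
        simp only [Pi.pow_apply, Real.norm_eq_abs, abs_pow, abs_norm]
        exact pow_le_pow_left₀ (norm_nonneg _) (hDb 0 h0 t) 2) _ _)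
    (((hDm 0).inner (hD'm 0)).const_mul 2).aestronglyMeasurable
    (Eventually.of_forall fun t _ ε hε => by
      rw [Real.norm_eq_abs, abs_mul, abs_two]
      gcongr
      exact (abs_real_inner_le_norm _ _).trans (mul_le_mul (hDb ε hε t) (hD'b ε hε t)
        (norm_nonneg _) ((norm_nonneg _).trans (hDb ε hε t))))
    intervalIntegrable_const
    (Eventually.of_forall fun t _ ε _ => hnorm t ε)).2
  have hDeriv : ∀ᵐ t, ∀ ε, deriv (fun t => R (γ t + ε • X t)) t = D ε t := by
    filter_upwards [hγ.ae_differentiableAt_real, hXu] with t h1 h2 ε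
    have e1 : HasDerivAt (fun t => γ t + ε • X t) (g t + ε • u t) t :=
      h1.hasDerivAt.add (h2.const_smul ε)
    exact (((hR.differentiable two_ne_zero _).hasFDerivAt).comp_hasDerivAt t e1).deriv
  have hD0 : ∀ᵐ t, D 0 t = g t := by
    filter_upwards [hDeriv] with t ht
    rw [← ht 0]
    simp only [zero_smul, add_zero, hRγ, hg]
  -- The Lipschitz bound keeps the energy of `γ` at most `L²`, which `hmin` makes a lower bound
  -- nearby; so `ε = 0` is a local minimum.
  have hE0 : ∫ t in (0 : ℝ)..1, ‖D 0 t‖ ^ 2 ≤ (L : ℝ) ^ 2 := by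
    have h1 : ∀ t ∈ uIoc (0 : ℝ) 1, ‖‖g t‖ ^ 2‖ ≤ (L : ℝ) ^ 2 := fun t _ => by
      rw [Real.norm_eq_abs, abs_pow, abs_norm]
      exact pow_le_pow_left₀ (norm_nonneg _) (hgb t) 2
    have h2 : ∫ t in (0 : ℝ)..1, ‖D 0 t‖ ^ 2 = ∫ t in (0 : ℝ)..1, ‖g t‖ ^ 2 :=
      intervalIntegral.integral_congr_ae (hD0.mono fun t ht _ => by rw [ht])
    rw [h2]
    refine (le_abs_self _).trans ?_
    have := intervalIntegral.norm_integral_le_of_norm_le_const h1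
    simpa using this
  have hlocmin : IsLocalMin (fun ε => ∫ t in (0 : ℝ)..1, ‖D ε t‖ ^ 2) 0 := by
    filter_upwards [hmin] with ε hε
    refine hE0.trans (hε.trans (le_of_eq ?_))
    exact intervalIntegral.integral_congr_ae (hDeriv.mono fun t ht _ => by rw [ht ε])
  have hz := hlocmin.hasDerivAt_eq_zero hmain
  rw [intervalIntegral.integral_const_mul] at hz
  have hz' : ∫ t in (0 : ℝ)..1, ⟪D 0 t, D' 0 t⟫ = 0 := by linarith
  refine (intervalIntegral.integral_congr_ae (hD0.mono fun t ht _ => ?_)).trans hz'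
  simp [hD', ht]

/-- A curve with Lipschitz constant `L` on the image of a `C^2` retraction, whose energy is not
less than `L ^ 2` even after variations, is of class `C^2`, and its second derivative is
orthogonal to the range of the derivative of the retraction. -/
theorem exists_velocity_of_energy_minimizing (hR : ContDiff ℝ 2 R) (hγ : LipschitzWith L γ)
    (hγx : ∀ t, γ t ∈ Metric.closedBall x ρ) (hRγ : ∀ t, R (γ t) = γ t)
    (hmin : ∀ (u : ℝ → E) (C : ℝ≥0), StronglyMeasurable u → (∀ t, ‖u t‖ ≤ C) →
      (∀ t ∉ Icc (0 : ℝ) 1, u t = 0) → ∫ t in (0 : ℝ)..1, u t = 0 → ∀ᶠ ε in 𝓝 (0 : ℝ),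
      (L : ℝ) ^ 2 ≤
        ∫ t in (0 : ℝ)..1, ‖deriv (fun t => R (γ t + ε • ∫ s in (0 : ℝ)..t, u s)) t‖ ^ 2) :
    ∃ V V' : ℝ → E, ContDiffOn ℝ 1 V (Icc 0 1) ∧
      (∀ t ∈ Icc (0 : ℝ) 1, HasDerivWithinAt γ (V t) (Icc 0 1) t) ∧
      (∀ t ∈ Icc (0 : ℝ) 1, HasDerivWithinAt V (V' t) (Icc 0 1) t) ∧
      ∀ t ∈ Icc (0 : ℝ) 1, ∀ e, ⟪V' t, fderiv ℝ R (γ t) e⟫ = 0 := by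
  set g := deriv γ with hg
  have hgm : StronglyMeasurable g := stronglyMeasurable_deriv γ
  have hgb : ∀ t, ‖g t‖ ≤ L := norm_deriv_le_of_lipschitzWith hγ
  set Q := fderiv ℝ R with hQ
  have hQ1 : ContDiff ℝ 1 Q := hR.fderiv_right (by norm_num)
  set DQ := fderiv ℝ Q with hDQ
  have hQc : Continuous Q := hQ1.continuous
  have hDQc : Continuous DQ := hQ1.continuous_fderiv one_ne_zero
  have hadjc : Continuous fun T : E →L[ℝ] E => ContinuousLinearMap.adjoint T :=
    ContinuousLinearMap.adjoint.continuous
  -- With `α` and `β` evaluated at `(γ, γ')`, the integrand of the first variation becomes `⟪α, X⟫ +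
  -- ⟪β, u⟫`, the form needed for du Bois-Reymond.
  set α : E × E → E := fun p => ContinuousLinearMap.adjoint ((DQ p.1).flip p.2) p.2 with hα
  set β : E × E → E := fun p => ContinuousLinearMap.adjoint (Q p.1) p.2 with hβ
  have hαc : Continuous α := by
    refine (hadjc.comp ?_).clm_apply continuous_snd
    have : Continuous fun p : E × E => (DQ p.1).flip :=
      (ContinuousLinearMap.flipₗᵢ ℝ E E E).continuous.comp (hDQc.comp continuous_fst)
    exact this.clm_apply continuous_snd
  have hβc : Continuous β := (hadjc.comp (hQc.comp continuous_fst)).clm_apply continuous_snd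
  have hcpt : IsCompact (Metric.closedBall x ρ ×ˢ Metric.closedBall (0 : E) L) :=
    (isCompact_closedBall _ _).prod (isCompact_closedBall _ _)
  have hmem : ∀ t, (γ t, g t) ∈ Metric.closedBall x ρ ×ˢ Metric.closedBall (0 : E) L := fun t =>
    ⟨hγx t, by simpa using! hgb t⟩
  have hγg : StronglyMeasurable fun t => (γ t, g t) :=
    hγ.continuous.stronglyMeasurable.prodMk hgm
  have bound : ∀ {φ : E × E → E}, Continuous φ → ∃ A : ℝ≥0, ∀ t, ‖φ (γ t, g t)‖ ≤ A := by
    intro φ hφ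
    obtain ⟨A, hA⟩ := hcpt.exists_bound_of_continuousOn hφ.continuousOn
    exact ⟨A.toNNReal, fun t => (hA _ (hmem t)).trans (Real.le_coe_toNNReal A)⟩
  obtain ⟨A, hA⟩ := bound hαc
  obtain ⟨B, hB⟩ := bound hβc
  have ham : StronglyMeasurable fun t => α (γ t, g t) := hαc.comp_stronglyMeasurable hγg
  have hbm : StronglyMeasurable fun t => β (γ t, g t) := hβc.comp_stronglyMeasurable hγg
  have hfix : ∀ᵐ t, Q (γ t) (g t) = g t := by
    filter_upwards [hγ.ae_differentiableAt_real] with t ht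
    have h1 := ((hR.differentiable two_ne_zero (γ t)).hasFDerivAt).comp_hasDerivAt t ht.hasDerivAt
    have h2 : R ∘ γ = γ := funext hRγ
    rw [h2] at h1
    exact h1.unique ht.hasDerivAt
  obtain ⟨c, hc⟩ := exists_ae_eq_const_add_integral ham hbm hA hB (by
    intro u C hum hC hu0 hu1
    have hUl := lipschitzWith_integral hum hC
    obtain ⟨D, _, hD⟩ := exists_bound_integral_of_bounded hum hC hu0
    have h := integral_firstVariation_eq_zero hR hγ hγx hRγ hum hC
      ((LocallyIntegrable.ae_hasDerivAt_integral (locallyIntegrable_of_bounded hum hC)).mono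
        fun t ht => ht 0) hUl.continuous hD (hmin u C hum hC hu0 hu1)
    refine (intervalIntegral.integral_congr fun t _ => ?_).trans h
    simp only [hα, hβ, ContinuousLinearMap.adjoint_inner_left, ContinuousLinearMap.flip_apply,
      inner_add_right]
    rfl)
  obtain ⟨Θ, hΘ, hΘinv⟩ := exists_contDiff_leftInverse_adjoint (E := E)
  have hΘc : Continuous Θ := hΘ.continuous
  set b : ℝ → E := fun t => c + ∫ s in (0 : ℝ)..t, α (γ s, g s) with hb
  have hbc : Continuous b := continuous_const.add (lipschitzWith_integral ham hA).continuous
  -- Du Bois-Reymond controls only `β`, the adjoint of `Q (γ t)` applied to the velocity. As `Q (γ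
  -- t)` fixes the velocity, `Θ` recovers it: `V` is a continuous representative of `γ'`. Then `γ`
  -- and `b` are `C^1`, and so is `V`.
  set V : ℝ → E := fun t => Θ (Q (γ t)) (b t) with hV
  have hVc : Continuous V := (hΘc.comp (hQc.comp hγ.continuous)).clm_apply hbc
  have hgV : ∀ᵐ t, t ∈ Ioc (0 : ℝ) 1 → g t = V t := by
    filter_upwards [hfix, hc] with t h1 h2 ht
    rw [hV]
    simp only
    rw [hb]
    simp only
    rw [← h2 ht]
    exact (hΘinv _ _ h1).symm
  have hprim : ∀ t ∈ Icc (0 : ℝ) 1, ∀ φ : E × E → E, ∫ s in (0 : ℝ)..t, φ (γ s, g s) =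
      ∫ s in (0 : ℝ)..t, φ (γ s, V s) := by
    intro t ht φ
    refine intervalIntegral.integral_congr_ae (hgV.mono fun s hs hst => ?_)
    rw [uIoc_of_le ht.1] at hst
    rw [hs ⟨hst.1, hst.2.trans ht.2⟩]
  have hγeq : EqOn γ (fun t => γ 0 + ∫ s in (0 : ℝ)..t, V s) (Icc 0 1) := by
    intro t ht
    have h1 := integral_deriv_eq_sub_of_lipschitzWith hγ 0 t
    have h2 := hprim t ht Prod.snd
    simp only at h2 ⊢
    rw [← h2, h1]
    abel
  have hγ' : ∀ t ∈ Icc (0 : ℝ) 1, HasDerivWithinAt γ (V t) (Icc 0 1) t := by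
    intro t ht
    have h1 : HasDerivAt (fun t => γ 0 + ∫ s in (0 : ℝ)..t, V s) (V t) t :=
      (hVc.integral_hasStrictDerivAt 0 t).hasDerivAt.const_add _
    exact h1.hasDerivWithinAt.congr hγeq (hγeq ht)
  have haV : Continuous fun t => α (γ t, V t) := hαc.comp (hγ.continuous.prodMk hVc)
  have hbeq : EqOn b (fun t => c + ∫ s in (0 : ℝ)..t, α (γ s, V s)) (Icc 0 1) := fun t ht => by
    simp only [hb, hprim t ht α]
  have hprim1 : ∀ {f : ℝ → E} (c : E), Continuous f →
      ContDiff ℝ 1 fun t => c + ∫ s in (0 : ℝ)..t, f s := by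
    intro f c hf
    have h1 : ∀ t, HasDerivAt (fun t => c + ∫ s in (0 : ℝ)..t, f s) (f t) t := fun t =>
      (hf.integral_hasStrictDerivAt 0 t).hasDerivAt.const_add _
    rw [contDiff_one_iff_deriv]
    refine ⟨fun t => (h1 t).differentiableAt, ?_⟩
    rwa [show deriv (fun t => c + ∫ s in (0 : ℝ)..t, f s) = f from funext fun t => (h1 t).deriv]
  have hb1 : ContDiffOn ℝ 1 b (Icc 0 1) := (hprim1 c haV).contDiffOn.congr hbeq
  have hγ1 : ContDiffOn ℝ 1 γ (Icc 0 1) := (hprim1 (γ 0) hVc).contDiffOn.congr hγeq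
  have hV1 : ContDiffOn ℝ 1 V (Icc 0 1) :=
    ((hΘ.comp hQ1).comp_contDiffOn hγ1).clm_apply hb1
  have hV' : ∀ t ∈ Icc (0 : ℝ) 1, HasDerivWithinAt V (derivWithin V (Icc 0 1) t) (Icc 0 1) t :=
    fun t ht => ((hV1.differentiableOn one_ne_zero) t ht).hasDerivWithinAt
  have hVb : EqOn (fun t => β (γ t, V t)) b (Icc 0 1) := by
    refine Measure.eqOn_Icc_of_ae_eq volume (zero_ne_one (α := ℝ)) ?_
      (hβc.comp (hγ.continuous.prodMk hVc)).continuousOn hbc.continuousOn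
    rw [Measure.restrict_congr_set Ioc_ae_eq_Icc.symm]
    refine (ae_restrict_iff' measurableSet_Ioc).2 ?_
    filter_upwards [hgV, hc] with t h1 h2 ht
    rw [← h1 ht, h2 ht]
  refine ⟨V, derivWithin V (Icc 0 1), hV1, hγ', hV', fun t ht e => ?_⟩
  -- Differentiating `⟪b, e⟫ = ⟪V, Q e⟫` in two ways leaves `⟪V', Q e⟫` once the second derivatives
  -- of `R` cancel by symmetry.
  have d1 : HasDerivWithinAt (fun s => ⟪b s, e⟫) ⟪α (γ t, V t), e⟫ (Icc 0 1) t := by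
    have h1 : HasDerivAt (fun t => c + ∫ s in (0 : ℝ)..t, α (γ s, V s)) (α (γ t, V t)) t :=
      (haV.integral_hasStrictDerivAt 0 t).hasDerivAt.const_add _
    have h2 := (h1.hasDerivWithinAt (s := Icc 0 1)).congr hbeq (hbeq ht)
    simpa using h2.inner ℝ (hasDerivWithinAt_const t (Icc (0 : ℝ) 1) e)
  have d2 : HasDerivWithinAt (fun s => ⟪V s, Q (γ s) e⟫)
      (⟪V t, DQ (γ t) (V t) e⟫ + ⟪derivWithin V (Icc 0 1) t, Q (γ t) e⟫) (Icc 0 1) t := by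
    have h1 : HasFDerivAt Q (DQ (γ t)) (γ t) := (hQ1.differentiable one_ne_zero _).hasFDerivAt
    have h2 := (h1.comp_hasDerivWithinAt t (hγ' t ht)).clm_apply
      (hasDerivWithinAt_const t (Icc (0 : ℝ) 1) e)
    simpa using! (hV' t ht).inner ℝ h2
  have d3 : HasDerivWithinAt (fun s => ⟪b s, e⟫)
      (⟪V t, DQ (γ t) (V t) e⟫ + ⟪derivWithin V (Icc 0 1) t, Q (γ t) e⟫) (Icc 0 1) t := by
    have h1 : EqOn (fun s => ⟪b s, e⟫) (fun s => ⟪V s, Q (γ s) e⟫) (Icc 0 1) := fun s hs => by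
      simp only [← hVb hs, hβ, ContinuousLinearMap.adjoint_inner_left]
    exact d2.congr h1 (h1 ht)
  have d4 := (uniqueDiffOn_Icc (zero_lt_one (α := ℝ)) t ht).eq_deriv _ d1 d3
  have hsymm : DQ (γ t) e (V t) = DQ (γ t) (V t) e :=
    (hR.contDiffAt.isSymmSndFDerivAt (by simp)) e (V t)
  simp only [hα, ContinuousLinearMap.adjoint_inner_left, ContinuousLinearMap.flip_apply, hsymm]
    at d4
  linarith

end Regularity

/-! ### Local retractions onto the submanifold -/

/-- `R` is a `C^2` map which retracts the closed ball of radius `ρ` about `x` into `M`. The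
constants `K` and `Λ` bound its first and its second derivative on this ball. -/
structure IsLocalRetraction {E : Type*} [NormedAddCommGroup E] [InnerProductSpace ℝ E]
    (M : Set E) (x : E) (R : E → E) (ρ : ℝ) (K Λ : ℝ≥0) : Prop where
  contDiff : ContDiff ℝ 2 R
  pos : 0 < ρ
  mapsTo : ∀ p ∈ Metric.closedBall x ρ, R p ∈ M
  eq_self : ∀ p ∈ Metric.closedBall x ρ, p ∈ M → R p = p
  norm_fderiv_le : ∀ p ∈ Metric.closedBall x ρ, ‖fderiv ℝ R p‖ ≤ K
  norm_fderiv_fderiv_le : ∀ p ∈ Metric.closedBall x ρ, ‖fderiv ℝ (fderiv ℝ R) p‖ ≤ Λ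
  mul_le_half : Λ * ρ ≤ 1 / 2

section Retraction

variable {n : ℕ} {M : Set (EuclideanSpace ℝ (Fin n))}
  {x y z p q ν : EuclideanSpace ℝ (Fin n)} {ρ : ℝ} {K Λ : ℝ≥0}
  {R : EuclideanSpace ℝ (Fin n) → EuclideanSpace ℝ (Fin n)}
  {γ η : ℝ → EuclideanSpace ℝ (Fin n)}

/-- Flatten `M` by `Φ`, project orthogonally onto `V` and return by `Φ.symm`; a bump function
extends this map to the whole space. -/
theorem IsC2Submanifold.exists_isLocalRetraction {m : ℕ} (hM : IsC2Submanifold m M) (hx : x ∈ M) :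
    ∃ R ρ K Λ, IsLocalRetraction M x R ρ K Λ := by
  obtain ⟨Φ, V, hxΦ, hΦ, hΦs, -, hΦM⟩ := hM x hx
  set P := V.starProjection with hP
  set R₀ : EuclideanSpace ℝ (Fin n) → EuclideanSpace ℝ (Fin n) := fun z => Φ.symm (P (Φ z)) with hR₀
  set W := Φ.source ∩ Φ ⁻¹' (P ⁻¹' Φ.target) with hW
  have hWo : IsOpen W := Φ.isOpen_inter_preimage (Φ.open_target.preimage P.continuous)
  have hfix : ∀ p ∈ Φ.source ∩ M, P (Φ p) = Φ p := by
    intro p hp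
    have : Φ p ∈ Φ.target ∩ (V : Set _) := hΦM ▸ mem_image_of_mem Φ hp
    exact Submodule.starProjection_eq_self_iff.2 this.2
  have hxW : x ∈ W := ⟨hxΦ, by
    rw [mem_preimage, mem_preimage, hfix x ⟨hxΦ, hx⟩]
    exact Φ.map_source hxΦ⟩
  have hR₀c : ContDiffOn ℝ 2 R₀ W :=
    hΦs.comp (P.contDiff.comp_contDiffOn (hΦ.mono inter_subset_left)) fun p hp => hp.2
  have hR₀M : ∀ p ∈ W, R₀ p ∈ M := by
    intro p hp
    have h1 : P (Φ p) ∈ Φ.target ∩ (V : Set _) := ⟨hp.2, Submodule.starProjection_apply_mem _ _⟩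
    rw [← hΦM] at h1
    obtain ⟨q, hq, hqe⟩ := h1
    simp only [hR₀, ← hqe, Φ.left_inv hq.1]
    exact hq.2
  have hR₀id : ∀ p ∈ W, p ∈ M → R₀ p = p := by
    intro p hp hpM
    simp only [hR₀, hfix p ⟨hp.1, hpM⟩, Φ.left_inv hp.1]
  obtain ⟨δ, hδ, hδW⟩ := Metric.isOpen_iff.1 hWo x hxW
  let c : ContDiffBump x := ⟨δ / 4, δ / 2, by positivity, by linarith⟩
  have hcW : Metric.closedBall x (δ / 2) ⊆ W :=
    (Metric.closedBall_subset_ball (by linarith)).trans hδW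
  set R : EuclideanSpace ℝ (Fin n) → EuclideanSpace ℝ (Fin n) := fun p => c p • R₀ p with hR
  have hRc : ContDiff ℝ 2 R := by
    rw [contDiff_iff_contDiffAt]
    intro p
    by_cases hp : p ∈ Metric.closedBall x (δ / 2)
    · exact c.contDiff.contDiffAt.smul (hR₀c.contDiffAt (hWo.mem_nhds (hcW hp)))
    · have h1 : p ∉ tsupport c := by rwa [c.tsupport_eq]
      have h2 := notMem_tsupport_iff_eventuallyEq.1 h1
      refine (contDiffAt_const (c := (0 : EuclideanSpace ℝ (Fin n)))).congr_of_eventuallyEq ?_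
      filter_upwards [h2] with q hq
      simp only [hR, hq, Pi.zero_apply, zero_smul]
  have hReq : ∀ p ∈ Metric.closedBall x (δ / 4), R p = R₀ p := by
    intro p hp
    simp only [hR, c.one_of_mem_closedBall hp, one_smul]
  have hQ1 : ContDiff ℝ 1 (fderiv ℝ R) := hRc.fderiv_right (by norm_num)
  have hcpt := isCompact_closedBall x (δ / 4)
  obtain ⟨K, hK⟩ := hcpt.exists_bound_of_continuousOn (f := fderiv ℝ R) hQ1.continuous.continuousOn
  obtain ⟨Λ, hΛ⟩ := hcpt.exists_bound_of_continuousOn (f := fderiv ℝ (fderiv ℝ R))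
    (hQ1.continuous_fderiv one_ne_zero).continuousOn
  -- The second term forces `Λ ρ ≤ 1 / 2`; the `+ 1` covers `Λ = 0`.
  set ρ := min (δ / 4) (1 / (2 * ((Λ.toNNReal : ℝ) + 1))) with hρ
  have hsub : Metric.closedBall x ρ ⊆ Metric.closedBall x (δ / 4) :=
    Metric.closedBall_subset_closedBall (min_le_left _ _)
  have hsubW : Metric.closedBall x ρ ⊆ W :=
    hsub.trans ((Metric.closedBall_subset_closedBall (by linarith)).trans hcW)
  have hΛ0 : (0 : ℝ) ≤ Λ.toNNReal := NNReal.coe_nonneg _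
  refine ⟨R, ρ, K.toNNReal, Λ.toNNReal, hRc, lt_min (by positivity) (by positivity), ?_, ?_, ?_,
    ?_, ?_⟩
  · intro p hp
    rw [hReq p (hsub hp)]
    exact hR₀M p (hsubW hp)
  · intro p hp hpM
    rw [hReq p (hsub hp)]
    exact hR₀id p (hsubW hp) hpM
  · exact fun p hp => (hK p (hsub hp)).trans (Real.le_coe_toNNReal K)
  · exact fun p hp => (hΛ p (hsub hp)).trans (Real.le_coe_toNNReal Λ)
  · have h1 : ρ ≤ 1 / (2 * ((Λ.toNNReal : ℝ) + 1)) := min_le_right _ _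
    calc (Λ.toNNReal : ℝ) * ρ ≤ Λ.toNNReal * (1 / (2 * ((Λ.toNNReal : ℝ) + 1))) := by gcongr
      _ ≤ 1 / 2 := by
        rw [mul_one_div, div_le_div_iff₀ (by positivity) (by norm_num)]
        linarith

namespace IsLocalRetraction

theorem contDiff_fderiv (h : IsLocalRetraction M x R ρ K Λ)
    : ContDiff ℝ 1 (fderiv ℝ R) := h.contDiff.fderiv_right (by norm_num)

theorem hasFDerivAt (h : IsLocalRetraction M x R ρ K Λ)
    (p : EuclideanSpace ℝ (Fin n)) : HasFDerivAt R (fderiv ℝ R p) p :=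
  (h.contDiff.differentiable two_ne_zero p).hasFDerivAt

theorem lipschitzOnWith (h : IsLocalRetraction M x R ρ K Λ)
    : LipschitzOnWith K R (Metric.closedBall x ρ) :=
  Convex.lipschitzOnWith_of_nnnorm_fderiv_le (𝕜 := ℝ)
    (fun p _ => h.contDiff.differentiable two_ne_zero p) (fun p hp => h.norm_fderiv_le p hp)
    (convex_closedBall x ρ)

theorem norm_sub_fderiv_le (h : IsLocalRetraction M x R ρ K Λ)
    (hp : p ∈ Metric.closedBall x ρ) (hq : q ∈ Metric.closedBall x ρ) :
    ‖R q - R p - fderiv ℝ R p (q - p)‖ ≤ Λ * ‖q - p‖ ^ 2 := by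
  have hseg : segment ℝ p q ⊆ Metric.closedBall x ρ := (convex_closedBall x ρ).segment_subset hp hq
  have key := Convex.norm_image_sub_le_of_norm_hasFDerivWithin_le' (𝕜 := ℝ) (f := R)
    (f' := fderiv ℝ R) (φ := fderiv ℝ R p) (C := Λ * ‖q - p‖) (s := segment ℝ p q) (x := p) (y := q)
    (fun w _ => (h.hasFDerivAt w).hasFDerivWithinAt) (fun w hw => by
      have h1 := Convex.norm_image_sub_le_of_norm_fderiv_le (𝕜 := ℝ) (f := fderiv ℝ R)
        (s := Metric.closedBall x ρ) (fun w _ => h.contDiff_fderiv.differentiable one_ne_zero w)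
        h.norm_fderiv_fderiv_le (convex_closedBall x ρ) hp (hseg hw)
      refine h1.trans ?_
      gcongr
      rw [segment_eq_image'] at hw
      obtain ⟨θ, hθ, rfl⟩ := hw
      rw [add_sub_cancel_left, norm_smul, Real.norm_eq_abs, abs_of_nonneg hθ.1]
      exact mul_le_of_le_one_left (norm_nonneg _) hθ.2)
    (convex_segment p q) (left_mem_segment ℝ p q) (right_mem_segment ℝ p q)
  calc _ ≤ Λ * ‖q - p‖ * ‖q - p‖ := key
    _ = _ := by ring

/-- With `fderiv_eq_self_of_mem_tangentSpace`, this makes the derivative of `R` at a point of `M` a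
projection, not necessarily orthogonal, onto the tangent space. -/
theorem fderiv_mem_tangentSpace (h : IsLocalRetraction M x R ρ K Λ)
    (hp : p ∈ M) (hpx : p ∈ Metric.ball x ρ)
    (e : EuclideanSpace ℝ (Fin n)) : fderiv ℝ R p e ∈ tangentSpace M p := by
  refine Submodule.subset_span ⟨fun t => R (p + t • e), ?_, ?_, ?_⟩
  · have hc : Tendsto (fun t : ℝ => p + t • e) (𝓝 0) (𝓝 p) := by
      have : Continuous fun t : ℝ => p + t • e := by fun_prop
      simpa using this.tendsto 0
    filter_upwards [hc (Metric.isOpen_ball.mem_nhds hpx)] with t ht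
    exact h.mapsTo _ (Metric.ball_subset_closedBall ht)
  · simp [h.eq_self p (Metric.ball_subset_closedBall hpx) hp]
  · have h1 : HasDerivAt (fun t : ℝ => p + t • e) e 0 := by
      simpa using ((hasDerivAt_id (0 : ℝ)).smul_const e).const_add p
    have h2 : HasFDerivAt R (fderiv ℝ R p) (p + (0 : ℝ) • e) := by
      simpa using h.hasFDerivAt p
    exact h2.comp_hasDerivAt 0 h1

theorem fderiv_eq_self_of_mem_tangentSpace (h : IsLocalRetraction M x R ρ K Λ)
    (hpx : p ∈ Metric.ball x ρ)
    {v : EuclideanSpace ℝ (Fin n)} (hv : v ∈ tangentSpace M p) : fderiv ℝ R p v = v := by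
  induction hv using Submodule.span_induction with
  | zero => simp
  | add a b _ _ ha hb => rw [map_add, ha, hb]
  | smul c a _ ha => rw [map_smul, ha]
  | mem v hv =>
    obtain ⟨γ, hγM, hγ0, hγ⟩ := hv
    have hev : ∀ᶠ t in 𝓝 0, γ t ∈ Metric.ball x ρ :=
      hγ.continuousAt (Metric.isOpen_ball.mem_nhds (by rwa [hγ0]))
    have h1 : R ∘ γ =ᶠ[𝓝 0] γ := by
      filter_upwards [hγM, hev] with t h1 h2
      exact h.eq_self _ (Metric.ball_subset_closedBall h2) h1
    have h2 : HasFDerivAt R (fderiv ℝ R p) (γ 0) := by rw [hγ0]; exact h.hasFDerivAt p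
    exact ((h2.comp_hasDerivAt 0 hγ).congr_of_eventuallyEq h1.symm).unique hγ

/-- `R` fixes `p` and `q`, so by Taylor's formula `q - p` is the tangent vector `fderiv ℝ R p (q -
p)` up to a quadratic error, and `ν` sees only the error. -/
theorem abs_inner_le_of_mem_normalSpace (h : IsLocalRetraction M x R ρ K Λ)
    (hp : p ∈ M) (hpx : p ∈ Metric.ball x ρ) (hq : q ∈ M)
    (hqx : q ∈ Metric.ball x ρ) (hν : ν ∈ normalSpace M p) :
    |⟪ν, q - p⟫| ≤ Λ * ‖ν‖ * ‖q - p‖ ^ 2 := by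
  have hp' := Metric.ball_subset_closedBall hpx
  have hq' := Metric.ball_subset_closedBall hqx
  have h1 := h.norm_sub_fderiv_le hp' hq'
  rw [h.eq_self p hp' hp, h.eq_self q hq' hq] at h1
  have h2 : ⟪ν, fderiv ℝ R p (q - p)⟫ = 0 :=
    (Submodule.mem_orthogonal' _ _).1 hν _ (h.fderiv_mem_tangentSpace hp hpx _)
  have h3 : ⟪ν, q - p⟫ = ⟪ν, q - p - fderiv ℝ R p (q - p)⟫ := by
    rw [inner_sub_right _ (q - p), h2, sub_zero]
  rw [h3]
  calc _ ≤ ‖ν‖ * (Λ * ‖q - p‖ ^ 2) :=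
        (abs_real_inner_le_norm _ _).trans (by gcongr)
    _ = _ := by ring

/-- The segment from `p` to `q`, pushed into `M` by `R`, is a competitor. -/
theorem riemDist_le (h : IsLocalRetraction M x R ρ K Λ)
    (hp : p ∈ M) (hpx : p ∈ Metric.closedBall x ρ) (hq : q ∈ M)
    (hqx : q ∈ Metric.closedBall x ρ) : riemDist M p q ≤ ENNReal.ofReal (K * ‖q - p‖) := by
  set c : ℝ → EuclideanSpace ℝ (Fin n) := fun t => R (p + t • (q - p)) with hc
  have hmem : ∀ t ∈ Icc (0 : ℝ) 1, p + t • (q - p) ∈ Metric.closedBall x ρ := fun t ht =>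
    (convex_closedBall x ρ).add_smul_sub_mem hpx hqx ht
  have hcd : ContDiff ℝ 1 c := (h.contDiff.of_le one_le_two).comp (by fun_prop)
  have hd : ∀ t, HasDerivAt c (fderiv ℝ R (p + t • (q - p)) (q - p)) t := by
    intro t
    have h1 : HasDerivAt (fun t : ℝ => p + t • (q - p)) (q - p) t := by
      simpa using ((hasDerivAt_id t).smul_const (q - p)).const_add p
    exact (h.hasFDerivAt _).comp_hasDerivAt t h1
  have h0 : c 0 = p := by simp [hc, h.eq_self p hpx hp]
  have h1 : c 1 = q := by simp [hc, h.eq_self q hqx hq]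
  refine (iInf₂_le c ⟨hcd.contDiffOn, fun t ht => h.mapsTo _ (hmem t ht), h0, h1⟩).trans ?_
  have hb : ∀ t ∈ Icc (0 : ℝ) 1, ‖velocity c t‖ₑ ≤ ENNReal.ofReal (K * ‖q - p‖) := by
    intro t ht
    rw [velocity, (hd t).hasDerivWithinAt.derivWithin (uniqueDiffOn_Icc one_pos t ht),
      ← ofReal_norm]
    exact ENNReal.ofReal_le_ofReal ((ContinuousLinearMap.le_opNorm _ _).trans
      (mul_le_mul_of_nonneg_right (h.norm_fderiv_le _ (hmem t ht)) (norm_nonneg _)))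
  refine (setLIntegral_mono' measurableSet_Icc hb).trans ?_
  simp

end IsLocalRetraction

theorem mem_tangentSpace_of_hasDerivAt {t : ℝ} {v : EuclideanSpace ℝ (Fin n)}
    (hγ : ∀ᶠ s in 𝓝 t, γ s ∈ M) (hv : HasDerivAt γ v t) : v ∈ tangentSpace M (γ t) := by
  refine Submodule.subset_span ⟨fun s => γ (t + s), ?_, by simp, ?_⟩
  · have : Tendsto (fun s : ℝ => t + s) (𝓝 0) (𝓝 t) := by
      have : Continuous fun s : ℝ => t + s := by fun_prop
      simpa using this.tendsto 0
    exact this hγ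
  · have := HasDerivAt.comp_const_add t 0 (f := γ) (f' := v) (by simpa using hv)
    exact this

/-! ### Speed and acceleration of geodesics -/

namespace IsGeodesic

theorem continuousOn (hγ : IsGeodesic M γ) : ContinuousOn γ (Icc 0 1) := hγ.1.continuousOn

theorem hasDerivWithinAt (hγ : IsGeodesic M γ) {t : ℝ} (ht : t ∈ Icc (0 : ℝ) 1) :
    HasDerivWithinAt γ (velocity γ t) (Icc 0 1) t :=
  (hγ.1.differentiableOn two_ne_zero t ht).hasDerivWithinAt

theorem contDiffOn_velocity (hγ : IsGeodesic M γ) : ContDiffOn ℝ 1 (velocity γ) (Icc 0 1) :=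
  ((contDiffOn_succ_iff_derivWithin (n := 1) (uniqueDiffOn_Icc one_pos)).1
    (by rw [one_add_one_eq_two]; exact hγ.1)).2.2

theorem hasDerivWithinAt_velocity (hγ : IsGeodesic M γ) {t : ℝ} (ht : t ∈ Icc (0 : ℝ) 1) :
    HasDerivWithinAt (velocity γ) (derivWithin (velocity γ) (Icc 0 1) t) (Icc 0 1) t :=
  (hγ.contDiffOn_velocity.differentiableOn one_ne_zero t ht).hasDerivWithinAt

theorem hasDerivAt (hγ : IsGeodesic M γ)
    {t : ℝ} (ht : t ∈ Ioo (0 : ℝ) 1) : HasDerivAt γ (velocity γ t) t :=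
  (hγ.hasDerivWithinAt (Ioo_subset_Icc_self ht)).hasDerivAt (Icc_mem_nhds ht.1 ht.2)

theorem hasDerivAt_velocity (hγ : IsGeodesic M γ) {t : ℝ} (ht : t ∈ Ioo (0 : ℝ) 1) :
    HasDerivAt (velocity γ) (derivWithin (velocity γ) (Icc 0 1) t) t :=
  (hγ.hasDerivWithinAt_velocity (Ioo_subset_Icc_self ht)).hasDerivAt (Icc_mem_nhds ht.1 ht.2)

theorem norm_velocity_eq (hγ : IsGeodesic M γ)
    {t : ℝ} (ht : t ∈ Icc (0 : ℝ) 1) : ‖velocity γ t‖ = ‖velocity γ 0‖ := by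
  have hc : ContinuousOn (derivWithin (velocity γ) (Icc 0 1)) (Icc 0 1) :=
    hγ.contDiffOn_velocity.continuousOn_derivWithin (uniqueDiffOn_Icc one_pos) le_rfl
  have hz : EqOn (fun t => ⟪velocity γ t, derivWithin (velocity γ) (Icc 0 1) t⟫) (fun _ => 0)
      (Icc 0 1) := by
    -- Tangent vectors are velocities of two-sided curves, so orthogonality is read off at interior
    -- times and reaches the ends by continuity.
    refine EqOn.of_subset_closure (s := Ioo 0 1) (fun t ht => ?_)
      (hγ.contDiffOn_velocity.continuousOn.inner hc) continuousOn_const Ioo_subset_Icc_self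
      (closure_Ioo zero_ne_one).symm.subset
    refine (Submodule.mem_orthogonal _ _).1 (hγ.2.2 t (Ioo_subset_Icc_self ht)) _ ?_
    refine mem_tangentSpace_of_hasDerivAt ?_ (hγ.hasDerivAt ht)
    filter_upwards [Icc_mem_nhds ht.1 ht.2] with s hs
    exact hγ.2.1 hs
  have hd : ∀ t ∈ Icc (0 : ℝ) 1,
      HasDerivWithinAt (fun t => ‖velocity γ t‖ ^ 2) 0 (Icc 0 1) t := by
    intro t ht
    have h1 := (hγ.hasDerivWithinAt_velocity ht).norm_sq
    have h2 := hz ht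
    simp only at h2
    rwa [h2, mul_zero] at h1
  have := constant_of_derivWithin_zero (fun t ht => (hd t ht).differentiableWithinAt)
    (fun t ht => (hd t (Ico_subset_Icc_self ht)).derivWithin
      (uniqueDiffOn_Icc one_pos t (Ico_subset_Icc_self ht))) t ht
  exact (pow_left_inj₀ (norm_nonneg _) (norm_nonneg _) two_ne_zero).1 this

theorem curveLength_eq (hγ : IsGeodesic M γ) : curveLength γ = ENNReal.ofReal ‖velocity γ 0‖ := by
  have : ∀ t ∈ Icc (0 : ℝ) 1, ‖velocity γ t‖ₑ = ENNReal.ofReal ‖velocity γ 0‖ := fun t ht => by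
    rw [← ofReal_norm, hγ.norm_velocity_eq ht]
  rw [curveLength, setLIntegral_congr_fun measurableSet_Icc this]
  simp

theorem norm_sub_le (hγ : IsGeodesic M γ)
    {t : ℝ} (ht : t ∈ Icc (0 : ℝ) 1) : ‖γ t - γ 0‖ ≤ ‖velocity γ 0‖ := by
  have h0 : (0 : ℝ) ∈ Icc (0 : ℝ) 1 := left_mem_Icc.2 zero_le_one
  have := Convex.norm_image_sub_le_of_norm_hasDerivWithin_le
    (fun s hs => hγ.hasDerivWithinAt hs) (fun s hs => (hγ.norm_velocity_eq hs).le)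
    (convex_Icc 0 1) h0 ht
  refine this.trans (mul_le_of_le_one_right (norm_nonneg _) ?_)
  rw [sub_zero, Real.norm_eq_abs, abs_of_nonneg ht.1]
  exact ht.2

/-- Differentiating `γ' = DR(γ) γ'` gives `γ'' = D²R(γ)(γ', γ') + DR(γ) γ''`. The last term is
tangent and `γ''` is normal, so pairing with `γ''` leaves only the `D²R` term. -/
theorem norm_derivWithin_velocity_le (hγ : IsGeodesic M γ) (h : IsLocalRetraction M x R ρ K Λ)
    (hx : ∀ t ∈ Icc (0 : ℝ) 1, γ t ∈ Metric.ball x ρ) {t : ℝ} (ht : t ∈ Icc (0 : ℝ) 1) :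
    ‖derivWithin (velocity γ) (Icc 0 1) t‖ ≤ Λ * ‖velocity γ 0‖ ^ 2 := by
  set a := derivWithin (velocity γ) (Icc 0 1) t with ha
  have hu := fun s (hs : s ∈ Icc (0 : ℝ) 1) => uniqueDiffOn_Icc (zero_lt_one (α := ℝ)) s hs
  have hfix : EqOn (velocity γ) (fun s => fderiv ℝ R (γ s) (velocity γ s)) (Icc 0 1) := by
    intro s hs
    have h1 := (h.hasFDerivAt (γ s)).comp_hasDerivWithinAt s (hγ.hasDerivWithinAt hs)
    have h2 : EqOn γ (R ∘ γ) (Icc 0 1) := fun r hr =>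
      (h.eq_self _ (Metric.ball_subset_closedBall (hx r hr)) (hγ.2.1 hr)).symm
    exact (hu s hs).eq_deriv _ (hγ.hasDerivWithinAt hs) (h1.congr h2 (h2 hs))
  have hQ : HasDerivWithinAt (fun s => fderiv ℝ R (γ s))
      (fderiv ℝ (fderiv ℝ R) (γ t) (velocity γ t)) (Icc 0 1) t :=
    (h.contDiff_fderiv.differentiable one_ne_zero (γ t)).hasFDerivAt.comp_hasDerivWithinAt t
      (hγ.hasDerivWithinAt ht)
  have h1 := (hQ.clm_apply (hγ.hasDerivWithinAt_velocity ht)).congr hfix (hfix ht)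
  have h2 := (hu t ht).eq_deriv _ (hγ.hasDerivWithinAt_velocity ht) h1
  have h3 : ⟪a, fderiv ℝ R (γ t) a⟫ = 0 := (Submodule.mem_orthogonal' _ _).1 (hγ.2.2 t ht) _
    (h.fderiv_mem_tangentSpace (hγ.2.1 ht) (hx t ht) _)
  have h4 : ‖a‖ * ‖a‖ ≤ ‖a‖ * (Λ * ‖velocity γ 0‖ ^ 2) := by
    calc ‖a‖ * ‖a‖ = ⟪a, a⟫ := (real_inner_self_eq_norm_mul_norm a).symm
      _ = ⟪a, fderiv ℝ (fderiv ℝ R) (γ t) (velocity γ t) (velocity γ t)⟫ := by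
        rw [← ha] at h2
        nth_rw 2 [h2]
        rw [inner_add_right, h3, add_zero]
      _ ≤ ‖a‖ * ‖fderiv ℝ (fderiv ℝ R) (γ t) (velocity γ t) (velocity γ t)‖ :=
        real_inner_le_norm _ _
      _ ≤ ‖a‖ * (Λ * ‖velocity γ 0‖ ^ 2) := by
        gcongr
        have h5 := ContinuousLinearMap.le_opNorm₂ (fderiv ℝ (fderiv ℝ R) (γ t)) (velocity γ t)
          (velocity γ t)
        rw [hγ.norm_velocity_eq ht, mul_assoc, ← sq] at h5
        exact h5.trans (mul_le_mul_of_nonneg_right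
          (h.norm_fderiv_fderiv_le _ (Metric.ball_subset_closedBall (hx t ht))) (sq_nonneg _))
  rcases (norm_nonneg a).eq_or_lt with h0 | h0
  · rw [← h0]; positivity
  · exact le_of_mul_le_mul_left h4 h0

theorem norm_sub_sub_velocity_le (hγ : IsGeodesic M γ) (h : IsLocalRetraction M x R ρ K Λ)
    (hx : ∀ t ∈ Icc (0 : ℝ) 1, γ t ∈ Metric.ball x ρ) :
    ‖γ 1 - γ 0 - velocity γ 0‖ ≤ Λ * ‖velocity γ 0‖ ^ 2 := by
  have h0 : (0 : ℝ) ∈ Icc (0 : ℝ) 1 := left_mem_Icc.2 zero_le_one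
  have h1 : (1 : ℝ) ∈ Icc (0 : ℝ) 1 := right_mem_Icc.2 zero_le_one
  have hv : ∀ t ∈ Icc (0 : ℝ) 1, ‖velocity γ t - velocity γ 0‖ ≤ Λ * ‖velocity γ 0‖ ^ 2 := by
    intro t ht
    have := Convex.norm_image_sub_le_of_norm_hasDerivWithin_le
      (fun s hs => hγ.hasDerivWithinAt_velocity hs)
      (fun s hs => hγ.norm_derivWithin_velocity_le h hx hs) (convex_Icc 0 1) h0 ht
    refine this.trans (mul_le_of_le_one_right (by positivity) ?_)
    rw [sub_zero, Real.norm_eq_abs, abs_of_nonneg ht.1]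
    exact ht.2
  have hd : ∀ t ∈ Icc (0 : ℝ) 1, HasDerivWithinAt (fun t => γ t - t • velocity γ 0)
      (velocity γ t - velocity γ 0) (Icc 0 1) t := by
    intro t ht
    simpa using! (hγ.hasDerivWithinAt ht).sub
      ((hasDerivWithinAt_id t (Icc (0 : ℝ) 1)).smul_const (velocity γ 0))
  have := Convex.norm_image_sub_le_of_norm_hasDerivWithin_le hd hv (convex_Icc 0 1) h0 h1
  simp only [one_smul, zero_smul, sub_zero, norm_one, mul_one] at this
  rwa [sub_right_comm] at this

end IsGeodesic

namespace IsMinimizingGeodesic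

theorem norm_velocity (hγ : IsMinimizingGeodesic M γ y z) :
    ‖velocity γ 0‖ = (riemDist M y z).toReal := by
  rw [← hγ.2.2.2, hγ.1.curveLength_eq, ENNReal.toReal_ofReal (norm_nonneg _)]

end IsMinimizingGeodesic

end Retraction

/-! ### Existence of minimizing geodesics -/

section Existence

variable {n : ℕ} {M : Set (EuclideanSpace ℝ (Fin n))}
  {x y z : EuclideanSpace ℝ (Fin n)} {ρ r : ℝ} {K Λ L : ℝ≥0}
  {R : EuclideanSpace ℝ (Fin n) → EuclideanSpace ℝ (Fin n)}
  {γ : ℝ → EuclideanSpace ℝ (Fin n)}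

/-- `L` is at most the total increment of every increasing bound for the increments of a curve in
`M` from `y` to `z`. -/
def IsLengthLowerBound (M : Set (EuclideanSpace ℝ (Fin n))) (y z : EuclideanSpace ℝ (Fin n))
    (L : ℝ≥0) : Prop :=
  ∀ (f : ℝ → EuclideanSpace ℝ (Fin n)) (ℓ : ℝ → ℝ) (T : ℝ≥0), MapsTo f (Icc 0 1) M →
    ContinuousOn ℓ (Icc 0 1) → ℓ 0 = 0 → ℓ 1 = T →
    (∀ s ∈ Icc (0 : ℝ) 1, ∀ t ∈ Icc (0 : ℝ) 1, ‖f s - f t‖ ≤ |ℓ s - ℓ t|) →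
    f 0 = y → f 1 = z → L ≤ T

/-- A curve for which a function `φ` bounds the velocity in the integral sense is at least as long
as a lower bound for the length. -/
theorem IsLengthLowerBound.le_integral (hL : IsLengthLowerBound M y z L)
    {f : ℝ → EuclideanSpace ℝ (Fin n)} {φ : ℝ → ℝ} (hf : MapsTo f (Icc 0 1) M)
    (hφ : IntervalIntegrable φ volume 0 1) (hφ0 : ∀ t, 0 ≤ φ t)
    (hfφ : ∀ s ∈ Icc (0 : ℝ) 1, ∀ t ∈ Icc (0 : ℝ) 1, s ≤ t → ‖f t - f s‖ ≤ ∫ r in s..t, φ r)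
    (h0 : f 0 = y) (h1 : f 1 = z) : (L : ℝ) ≤ ∫ t in (0 : ℝ)..1, φ t := by
  have hnn : 0 ≤ ∫ t in (0 : ℝ)..1, φ t :=
    intervalIntegral.integral_nonneg zero_le_one fun t _ => hφ0 t
  have hsub : ∀ s ∈ Icc (0 : ℝ) 1, ∀ t ∈ Icc (0 : ℝ) 1, IntervalIntegrable φ volume s t :=
    fun s hs t ht => hφ.mono_set (by
      rw [uIcc_of_le zero_le_one]
      exact uIcc_subset_Icc hs ht)
  have hz : (0 : ℝ) ∈ Icc (0 : ℝ) 1 := left_mem_Icc.2 zero_le_one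
  have hcont : ContinuousOn (fun t => ∫ s in (0 : ℝ)..t, φ s) (Icc 0 1) := by
    have := intervalIntegral.continuousOn_primitive_interval' hφ left_mem_uIcc
    rwa [uIcc_of_le zero_le_one] at this
  have hle : ∀ s ∈ Icc (0 : ℝ) 1, ∀ t ∈ Icc (0 : ℝ) 1, s ≤ t →
      ‖f t - f s‖ ≤ |(∫ r in (0 : ℝ)..t, φ r) - ∫ r in (0 : ℝ)..s, φ r| := by
    intro s hs t ht hst
    rw [intervalIntegral.integral_interval_sub_left (hsub 0 hz t ht) (hsub 0 hz s hs)]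
    exact (hfφ s hs t ht hst).trans (le_abs_self _)
  have := hL f (fun t => ∫ s in (0 : ℝ)..t, φ s) ⟨_, hnn⟩ hf hcont (by simp) rfl (by
    intro s hs t ht
    rcases le_total s t with hst | hst
    · rw [norm_sub_rev, abs_sub_comm]
      exact hle s hs t ht hst
    · exact hle t ht s hs hst) h0 h1
  exact_mod_cast this

/-- The arc length of a `C^1` curve is an admissible bound for its increments, even where the
velocity vanishes. -/
theorem IsLengthLowerBound.le_riemDist (hL : IsLengthLowerBound M y z L) :
    (L : ℝ≥0∞) ≤ riemDist M y z := by
  refine le_iInf₂ fun c hc => ?_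
  obtain ⟨hc1, hcM, hc0, hc1'⟩ := hc
  have hu := uniqueDiffOn_Icc (zero_lt_one (α := ℝ))
  have hv : ContinuousOn (velocity c) (Icc 0 1) := hc1.continuousOn_derivWithin hu le_rfl
  have hd : ∀ t ∈ Ioo (0 : ℝ) 1, HasDerivAt c (velocity c t) t := fun t ht =>
    (hc1.differentiableOn one_ne_zero t (Ioo_subset_Icc_self ht)).hasDerivWithinAt.hasDerivAt
      (Icc_mem_nhds ht.1 ht.2)
  have hi : IntervalIntegrable (velocity c) volume 0 1 :=
    hv.intervalIntegrable_of_Icc zero_le_one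
  have key := hL.le_integral hcM hi.norm (fun t => norm_nonneg _) (fun s hs t ht hst => by
    have hsub : Icc s t ⊆ Icc 0 1 := Icc_subset_Icc hs.1 ht.2
    rw [← intervalIntegral.integral_eq_sub_of_hasDerivAt_of_le hst (hc1.continuousOn.mono hsub)
      (fun w hw => hd w ⟨hs.1.trans_lt hw.1, hw.2.trans_le ht.2⟩)
      ((hv.mono hsub).intervalIntegrable_of_Icc hst)]
    exact intervalIntegral.norm_integral_le_integral_norm hst) hc0 hc1'
  rw [intervalIntegral.integral_of_le zero_le_one, ← integral_Icc_eq_integral_Ioc] at key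
  rw [curveLength, ← ofReal_integral_norm_eq_lintegral_enorm hv.integrableOn_Icc]
  rw [← ENNReal.ofReal_coe_nnreal]
  exact ENNReal.ofReal_le_ofReal key

theorem sq_intervalIntegral_le {φ : ℝ → ℝ} (hφ : IntervalIntegrable φ volume 0 1)
    (hφ2 : IntervalIntegrable (fun t => φ t ^ 2) volume 0 1) :
    (∫ t in (0 : ℝ)..1, φ t) ^ 2 ≤ ∫ t in (0 : ℝ)..1, φ t ^ 2 := by
  set m := ∫ t in (0 : ℝ)..1, φ t with hm
  have h1 : 0 ≤ ∫ t in (0 : ℝ)..1, (φ t ^ 2 - 2 * m * φ t + m ^ 2) :=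
    intervalIntegral.integral_nonneg zero_le_one fun t _ => by nlinarith [sq_nonneg (φ t - m)]
  rw [intervalIntegral.integral_add (hφ2.sub (hφ.const_mul _)) intervalIntegrable_const,
    intervalIntegral.integral_sub hφ2 (hφ.const_mul _), intervalIntegral.integral_const_mul,
    ← hm] at h1
  simp only [intervalIntegral.integral_const, sub_zero, one_smul] at h1
  nlinarith

/-- Cauchy–Schwarz passes from length to energy, whose first variation is available. -/
theorem IsLengthLowerBound.sq_le_energy (hL : IsLengthLowerBound M y z L)
    {f : ℝ → EuclideanSpace ℝ (Fin n)} {C : ℝ≥0} (hfl : LipschitzWith C f)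
    (hf : MapsTo f (Icc 0 1) M) (h0 : f 0 = y) (h1 : f 1 = z) :
    (L : ℝ) ^ 2 ≤ ∫ t in (0 : ℝ)..1, ‖deriv f t‖ ^ 2 := by
  have hm : StronglyMeasurable (deriv f) := stronglyMeasurable_deriv f
  have hb := norm_deriv_le_of_lipschitzWith hfl
  have hi := (intervalIntegrable_of_bounded hm.aestronglyMeasurable
    (Eventually.of_forall hb) 0 1).norm
  have hi2 : IntervalIntegrable (fun t => ‖deriv f t‖ ^ 2) volume 0 1 :=
    intervalIntegrable_of_bounded (C := (C : ℝ) ^ 2) (hm.norm.pow 2).aestronglyMeasurable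
      (Eventually.of_forall fun t => by
        simp only [Pi.pow_apply, Real.norm_eq_abs, abs_pow, abs_norm]
        exact pow_le_pow_left₀ (norm_nonneg _) (hb t) 2) _ _
  refine le_trans (pow_le_pow_left₀ L.2 ?_ 2) (sq_intervalIntegral_le hi hi2)
  exact hL.le_integral hf hi (fun t => norm_nonneg _)
    (fun s _ t _ hst => norm_sub_le_integral_norm_deriv hfl hst) h0 h1

/-- This is the purpose of `hr`: a curve from `y` of length at most `K ‖z - y‖ ≤ 2 K r` stays within
`2 K r + r` of `x`. -/
theorem norm_sub_lt_half (hr : (2 * K + 1) * r ≤ ρ / 2) (hy : y ∈ Metric.ball x r)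
    (hz : z ∈ Metric.ball x r) {p : EuclideanSpace ℝ (Fin n)} (hp : ‖p - y‖ ≤ K * ‖z - y‖) :
    ‖p - x‖ < ρ / 2 := by
  rw [mem_ball_iff_norm] at hy hz
  have h1 : ‖z - y‖ ≤ 2 * r := by
    calc ‖z - y‖ = ‖(z - x) - (y - x)‖ := by congr 1; abel
      _ ≤ ‖z - x‖ + ‖y - x‖ := norm_sub_le _ _
      _ ≤ 2 * r := by linarith
  have h2 : (K : ℝ) * ‖z - y‖ ≤ K * (2 * r) := by gcongr
  calc ‖p - x‖ = ‖(p - y) + (y - x)‖ := by congr 1; abel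
    _ ≤ ‖p - y‖ + ‖y - x‖ := norm_add_le _ _
    _ < ρ / 2 := by linarith

namespace IsLocalRetraction

theorem exists_lipschitzWith_isLengthLowerBound (h : IsLocalRetraction M x R ρ K Λ)
    (hr : (2 * K + 1) * r ≤ ρ / 2) (hyM : y ∈ M)
    (hy : y ∈ Metric.ball x r) (hzM : z ∈ M) (hz : z ∈ Metric.ball x r) :
    ∃ (L : ℝ≥0) (γ : ℝ → EuclideanSpace ℝ (Fin n)), LipschitzWith L γ ∧
      (∀ t, γ t ∈ Metric.closedBall x (ρ / 2) ∧ γ t ∈ M) ∧ γ 0 = y ∧ γ 1 = z ∧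
      IsLengthLowerBound M y z L := by
  have hρ := h.pos
  have hhalf : Metric.closedBall x (ρ / 2) ⊆ Metric.closedBall x ρ :=
    Metric.closedBall_subset_closedBall (by linarith)
  set L₀ : ℝ≥0 := K * nndist z y with hL₀
  have hL₀' : (L₀ : ℝ) = K * ‖z - y‖ := by simp [hL₀, dist_eq_norm]
  have hnear : ∀ {p}, ‖p - y‖ ≤ L₀ → p ∈ Metric.closedBall x (ρ / 2) := by
    intro p hp
    rw [mem_closedBall_iff_norm]
    exact (norm_sub_lt_half hr hy hz (hL₀' ▸ hp)).le
  have hyx : y ∈ Metric.closedBall x ρ := hhalf (hnear (by simp))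
  have hzx : z ∈ Metric.closedBall x ρ := by
    rw [mem_closedBall_iff_norm]
    rw [mem_ball_iff_norm] at hz
    have : r ≤ ρ := by nlinarith [K.2, norm_nonneg (z - x), show (0 : ℝ) ≤ K from K.2]
    linarith
  have hKc : IsCompact (Metric.closedBall x (ρ / 2) ∩ M) := by
    have : Metric.closedBall x (ρ / 2) ∩ M = Metric.closedBall x (ρ / 2) ∩ {p | R p = p} := by
      ext p
      refine ⟨fun hp => ⟨hp.1, h.eq_self p (hhalf hp.1) hp.2⟩, fun hp => ⟨hp.1, ?_⟩⟩
      have h1 := h.mapsTo p (hhalf hp.1)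
      rwa [show R p = p from hp.2] at h1
    rw [this]
    exact (isCompact_closedBall _ _).inter_right
      (isClosed_eq h.contDiff.continuous continuous_id)
  have hseg : ∀ t ∈ Icc (0 : ℝ) 1, y + t • (z - y) ∈ Metric.closedBall x ρ := fun t ht =>
    (convex_closedBall x ρ).add_smul_sub_mem hyx hzx ht
  obtain ⟨f, hf, hfM, hf0, hf1⟩ := exists_lipschitzWith_reparametrization
    (f := fun t => R (y + t • (z - y))) (ℓ := fun t => L₀ * t) (M := M) (L := L₀)
    (fun t ht => h.mapsTo _ (hseg t ht)) (by fun_prop) (by simp) (by simp) (by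
      intro s hs t ht
      have h1 := h.lipschitzOnWith.dist_le_mul _ (hseg s hs) _ (hseg t ht)
      rw [dist_eq_norm, dist_eq_norm, add_sub_add_left_eq_sub, ← sub_smul, norm_smul,
        Real.norm_eq_abs] at h1
      refine h1.trans (le_of_eq ?_)
      rw [← mul_sub, abs_mul, NNReal.abs_eq, hL₀']
      ring)
  simp only [zero_smul, add_zero, one_smul, add_sub_cancel, h.eq_self y hyx hyM,
    h.eq_self z hzx hzM] at hf0 hf1 hfM
  obtain ⟨L, γ, hLL₀, hγ, hγK, hγ0, hγ1, hmin⟩ := exists_minimal_lipschitzWith hKc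
    ⟨f, hf, fun t => ⟨hnear (hfM t).2, (hfM t).1⟩, hf0, hf1⟩
  refine ⟨L, γ, hγ, hγK, hγ0, hγ1, fun c ℓ L' hc hℓ hℓ0 hℓ1 hinc hc0 hc1 => ?_⟩
  -- Minimality is known only inside the ball of radius `ρ / 2`. A shorter curve has length at most
  -- `L₀`, so its reparametrization cannot leave that ball.
  by_contra hlt
  obtain ⟨g, hg, hgM, hg0, hg1⟩ := exists_lipschitzWith_reparametrization hc hℓ hℓ0 hℓ1 hinc
  have hL' : (L' : ℝ) ≤ L₀ := by exact_mod_cast (not_le.1 hlt).le.trans hLL₀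
  refine hlt (hmin L' g hg (fun t => ⟨hnear ?_, (hgM t).1⟩) (hg0.trans hc0) (hg1.trans hc1))
  rw [← hc0]
  exact (hgM t).2.trans hL'

theorem exists_isMinimizingGeodesic (h : IsLocalRetraction M x R ρ K Λ)
    (hr : (2 * K + 1) * r ≤ ρ / 2) (hyM : y ∈ M)
    (hy : y ∈ Metric.ball x r) (hzM : z ∈ M) (hz : z ∈ Metric.ball x r) :
    ∃ γ, IsMinimizingGeodesic M γ y z := by
  have hρ := h.pos
  obtain ⟨L, γ, hγ, hγK, hγ0, hγ1, hL⟩ :=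
    h.exists_lipschitzWith_isLengthLowerBound hr hyM hy hzM hz
  have hhalf : Metric.closedBall x (ρ / 2) ⊆ Metric.closedBall x ρ :=
    Metric.closedBall_subset_closedBall (by linarith)
  obtain ⟨V, V', hV1, hγV, hVV', hN⟩ := exists_velocity_of_energy_minimizing h.contDiff hγ
    (fun t => (hγK t).1) (fun t => h.eq_self _ (hhalf (hγK t).1) (hγK t).2) (by
      intro u C hum hC hu0 hu1
      obtain ⟨B, hB0, hB⟩ := exists_bound_integral_of_bounded hum hC hu0
      have hXl := lipschitzWith_integral hum hC
      -- For these `ε` the variation moves points by at most `ρ / 2`, so `γ + ε X` stays where `R`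
      -- takes values in `M`.
      filter_upwards [Metric.ball_mem_nhds (0 : ℝ) (show 0 < ρ / 2 / (B + 1) by positivity)]
        with ε hε
      have hmem : ∀ t, γ t + ε • ∫ s in (0 : ℝ)..t, u s ∈ Metric.closedBall x ρ := by
        intro t
        have h1 := (hγK t).1
        rw [mem_closedBall_iff_norm] at h1 ⊢
        rw [mem_ball_zero_iff, lt_div_iff₀ (by positivity)] at hε
        have h2 : ‖ε • ∫ s in (0 : ℝ)..t, u s‖ ≤ ρ / 2 := by
          rw [norm_smul]
          calc _ ≤ ‖ε‖ * (B + 1) := by gcongr; linarith [hB t]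
            _ ≤ _ := hε.le
        calc _ = ‖(γ t - x) + ε • ∫ s in (0 : ℝ)..t, u s‖ := by congr 1; abel
          _ ≤ _ := norm_add_le _ _
          _ ≤ ρ := by linarith
      have hl : LipschitzWith (K * (L + ‖ε‖₊ * C))
          (fun t => R (γ t + ε • ∫ s in (0 : ℝ)..t, u s)) := by
        have h1 : LipschitzWith (L + ‖ε‖₊ * C) fun t => γ t + ε • ∫ s in (0 : ℝ)..t, u s :=
          hγ.add ((lipschitzWith_smul ε).comp hXl)
        refine LipschitzWith.of_dist_le_mul fun s t => ?_
        refine (h.lipschitzOnWith.dist_le_mul _ (hmem s) _ (hmem t)).trans ?_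
        rw [NNReal.coe_mul, mul_assoc]
        gcongr
        exact h1.dist_le_mul s t
      refine hL.sq_le_energy hl (fun t _ => h.mapsTo _ (hmem t)) ?_ ?_
      · simp only [intervalIntegral.integral_same, smul_zero, add_zero, hγ0]
        exact h.eq_self y (hhalf (hγ0 ▸ (hγK 0).1)) hyM
      · simp only [hu1, smul_zero, add_zero, hγ1]
        exact h.eq_self z (hhalf (hγ1 ▸ (hγK 1).1)) hzM)
  have hu := uniqueDiffOn_Icc (zero_lt_one (α := ℝ))
  have hvel : EqOn (velocity γ) V (Icc 0 1) := fun t ht => (hγV t ht).derivWithin (hu t ht)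
  have hγ2 : ContDiffOn ℝ 2 γ (Icc 0 1) := by
    have := (contDiffOn_succ_iff_derivWithin (n := 1) hu).2
      ⟨fun t ht => (hγV t ht).differentiableWithinAt, by simp, hV1.congr hvel⟩
    rwa [one_add_one_eq_two] at this
  have hγM : MapsTo γ (Icc 0 1) M := fun t _ => (hγK t).2
  have hball : ∀ t, γ t ∈ Metric.ball x ρ := fun t =>
    Metric.closedBall_subset_ball (by linarith) (hγK t).1
  refine ⟨γ, ⟨hγ2, hγM, fun t ht => ?_⟩, hγ0, hγ1, le_antisymm ?_ ?_⟩
  · rw [derivWithin_congr hvel (hvel ht), (hVV' t ht).derivWithin (hu t ht)]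
    refine (Submodule.mem_orthogonal' _ _).2 fun v hv => ?_
    rw [← h.fderiv_eq_self_of_mem_tangentSpace (hball t) hv]
    exact hN t ht v
  · refine le_trans ?_ hL.le_riemDist
    have hb : ∀ᵐ t ∂(volume.restrict (Icc (0 : ℝ) 1)), ‖velocity γ t‖ₑ ≤ L := by
      rw [Measure.restrict_congr_set Ioo_ae_eq_Icc.symm]
      filter_upwards [ae_restrict_mem measurableSet_Ioo] with t ht
      have h1 : HasDerivAt γ (velocity γ t) t := by
        rw [hvel (Ioo_subset_Icc_self ht)]
        exact (hγV t (Ioo_subset_Icc_self ht)).hasDerivAt (Icc_mem_nhds ht.1 ht.2)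
      rw [← h1.deriv, enorm_le_coe]
      exact norm_deriv_le_of_lipschitzWith hγ t
    refine (lintegral_mono_ae hb).trans ?_
    simp
  · exact iInf₂_le γ ⟨hγ2.of_le one_le_two, hγM, hγ0, hγ1⟩

end IsLocalRetraction

end Existence

/-! ### Uniqueness of minimizing geodesics and convexity of small balls -/

section Convexity

variable {n : ℕ} {M : Set (EuclideanSpace ℝ (Fin n))}
  {x y z : EuclideanSpace ℝ (Fin n)} {ρ r : ℝ} {K Λ : ℝ≥0}
  {R : EuclideanSpace ℝ (Fin n) → EuclideanSpace ℝ (Fin n)}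
  {γ η : ℝ → EuclideanSpace ℝ (Fin n)}

/-- With `m = max f`, the function `f + m t² / 2` is convex, so it is at most its larger end value
`m / 2`. At a maximum point of `f` this gives `m ≤ m / 2`. -/
theorem eq_zero_of_neg_le_deriv2 {f f' f'' : ℝ → ℝ} (hf : ContinuousOn f (Icc 0 1))
    (hf' : ∀ t ∈ Ioo (0 : ℝ) 1, HasDerivAt f (f' t) t)
    (hf'' : ∀ t ∈ Ioo (0 : ℝ) 1, HasDerivAt f' (f'' t) t) (hnn : ∀ t ∈ Icc (0 : ℝ) 1, 0 ≤ f t)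
    (hge : ∀ t ∈ Ioo (0 : ℝ) 1, -f t ≤ f'' t) (h0 : f 0 = 0) (h1 : f 1 = 0) :
    ∀ t ∈ Icc (0 : ℝ) 1, f t = 0 := by
  obtain ⟨s, hs, hmax⟩ := isCompact_Icc.exists_isMaxOn (nonempty_Icc.2 zero_le_one) hf
  have hconv : ConvexOn ℝ (Icc (0 : ℝ) 1) fun t => f t + f s / 2 * t ^ 2 := by
    refine convexOn_of_hasDerivWithinAt2_nonneg (convex_Icc 0 1)
      (f' := fun t => f' t + f s * t) (f'' := fun t => f'' t + f s)
      (hf.add (by fun_prop)) ?_ ?_ ?_ <;> rw [interior_Icc] <;> intro t ht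
    · have h2 : HasDerivAt (fun t : ℝ => f s / 2 * t ^ 2) (f s * t) t := by
        have := (hasDerivAt_pow 2 t).const_mul (f s / 2)
        have e : f s / 2 * (((2 : ℕ) : ℝ) * t ^ (2 - 1)) = f s * t := by norm_num; ring
        rwa [e] at this
      exact ((hf' t ht).add h2).hasDerivWithinAt
    · have h2 : HasDerivAt (fun t : ℝ => f s * t) (f s) t := by
        simpa using (hasDerivAt_id t).const_mul (f s)
      exact ((hf'' t ht).add h2).hasDerivWithinAt
    · have h2 := hge t ht
      have h3 : f t ≤ f s := hmax (Ioo_subset_Icc_self ht)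
      linarith
  have h2 := hconv.le_max_of_mem_Icc (left_mem_Icc.2 zero_le_one) (right_mem_Icc.2 zero_le_one) hs
  have h3 := hnn s hs
  rw [h0, h1] at h2
  have h4 : max ((0 : ℝ) + f s / 2 * 0 ^ 2) (0 + f s / 2 * 1 ^ 2) = f s / 2 := by
    rw [max_eq_right] <;> linarith
  rw [h4] at h2
  have h5 : f s ≤ 0 := by nlinarith [sq_nonneg s]
  exact fun t ht => le_antisymm ((hmax ht).trans h5) (hnn t ht)

namespace IsLocalRetraction

theorem ball_subset_closedBall (h : IsLocalRetraction M x R ρ K Λ) (hr : (2 * K + 1) * r ≤ ρ / 2) :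
    Metric.ball x r ⊆ Metric.closedBall x ρ := by
  refine Metric.ball_subset_closedBall.trans (Metric.closedBall_subset_closedBall ?_)
  have hK : (0 : ℝ) ≤ K := K.2
  have := h.pos
  by_contra hlt
  nlinarith

theorem norm_velocity_le (h : IsLocalRetraction M x R ρ K Λ)
    (hr : (2 * K + 1) * r ≤ ρ / 2) (hyM : y ∈ M)
    (hy : y ∈ Metric.ball x r) (hzM : z ∈ M) (hz : z ∈ Metric.ball x r)
    (hγ : IsMinimizingGeodesic M γ y z) : ‖velocity γ 0‖ ≤ K * ‖z - y‖ := by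
  rw [hγ.norm_velocity]
  refine ENNReal.toReal_le_of_le_ofReal (by positivity) ?_
  exact h.riemDist_le hyM (h.ball_subset_closedBall hr hy) hzM (h.ball_subset_closedBall hr hz)

theorem mem_ball_of_isMinimizingGeodesic (h : IsLocalRetraction M x R ρ K Λ)
    (hr : (2 * K + 1) * r ≤ ρ / 2) (hyM : y ∈ M)
    (hy : y ∈ Metric.ball x r) (hzM : z ∈ M) (hz : z ∈ Metric.ball x r)
    (hγ : IsMinimizingGeodesic M γ y z) : ∀ t ∈ Icc (0 : ℝ) 1, γ t ∈ Metric.ball x ρ := by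
  intro t ht
  have h1 := (hγ.1.norm_sub_le ht).trans (h.norm_velocity_le hr hyM hy hzM hz hγ)
  rw [hγ.2.1] at h1
  rw [mem_ball_iff_norm]
  linarith [norm_sub_lt_half hr hy hz h1, h.pos]

theorem mul_norm_velocity_le (h : IsLocalRetraction M x R ρ K Λ)
    (hr : (2 * K + 1) * r ≤ ρ / 2) (hyM : y ∈ M)
    (hy : y ∈ Metric.ball x r) (hzM : z ∈ M) (hz : z ∈ Metric.ball x r)
    (hγ : IsMinimizingGeodesic M γ y z) : Λ * ‖velocity γ 0‖ ≤ 1 / 2 := by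
  have h1 := h.norm_velocity_le hr hyM hy hzM hz hγ
  rw [mem_ball_iff_norm] at hy hz
  have h2 : ‖z - y‖ ≤ 2 * r := by
    calc ‖z - y‖ = ‖(z - x) - (y - x)‖ := by congr 1; abel
      _ ≤ ‖z - x‖ + ‖y - x‖ := norm_sub_le _ _
      _ ≤ 2 * r := by linarith
  have h3 : (K : ℝ) * ‖z - y‖ ≤ K * (2 * r) := by gcongr
  have h4 : ‖velocity γ 0‖ ≤ ρ := by linarith [norm_nonneg (z - x), h.pos]
  exact (mul_le_mul_of_nonneg_left h4 Λ.2).trans h.mul_le_half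

/-- The accelerations are normal, so their products with `η - γ` are quadratic in `‖η - γ‖`. Each
coefficient is at most `(Λ ‖velocity γ 0‖)² ≤ 1 / 4`, whence `f'' ≥ -f` for `f = ‖η - γ‖²`. -/
theorem eqOn_of_isMinimizingGeodesic (h : IsLocalRetraction M x R ρ K Λ)
    (hr : (2 * K + 1) * r ≤ ρ / 2) (hyM : y ∈ M)
    (hy : y ∈ Metric.ball x r) (hzM : z ∈ M) (hz : z ∈ Metric.ball x r)
    (hγ : IsMinimizingGeodesic M γ y z) (hη : IsMinimizingGeodesic M η y z) :
    EqOn η γ (Icc 0 1) := by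
  have hγx := h.mem_ball_of_isMinimizingGeodesic hr hyM hy hzM hz hγ
  have hηx := h.mem_ball_of_isMinimizingGeodesic hr hyM hy hzM hz hη
  have hsmall := h.mul_norm_velocity_le hr hyM hy hzM hz hγ
  have hd : ‖velocity η 0‖ = ‖velocity γ 0‖ := hη.norm_velocity.trans hγ.norm_velocity.symm
  have hsq : (Λ * ‖velocity γ 0‖) ^ 2 ≤ 1 / 4 :=
    (pow_le_pow_left₀ (by positivity) hsmall 2).trans (by norm_num)
  have key := eq_zero_of_neg_le_deriv2 (f := fun t => ‖η t - γ t‖ ^ 2)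
    (f' := fun t => 2 * ⟪η t - γ t, velocity η t - velocity γ t⟫)
    (f'' := fun t => 2 * (⟪η t - γ t, derivWithin (velocity η) (Icc 0 1) t -
      derivWithin (velocity γ) (Icc 0 1) t⟫ +
      ⟪velocity η t - velocity γ t, velocity η t - velocity γ t⟫))
    ((hη.1.continuousOn.sub hγ.1.continuousOn).norm.pow 2)
    (fun t ht => ((hη.1.hasDerivAt ht).sub (hγ.1.hasDerivAt ht)).norm_sq)
    (fun t ht => (((hη.1.hasDerivAt ht).sub (hγ.1.hasDerivAt ht)).inner ℝ
      ((hη.1.hasDerivAt_velocity ht).sub (hγ.1.hasDerivAt_velocity ht))).const_mul 2)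
    (fun t _ => sq_nonneg _) (fun t ht => ?_) (by simp [hη.2.1, hγ.2.1])
    (by simp [hη.2.2.1, hγ.2.2.1])
  · intro t ht
    have := key t ht
    rwa [sq_eq_zero_iff, norm_eq_zero, sub_eq_zero] at this
  · have ht' := Ioo_subset_Icc_self ht
    set a := derivWithin (velocity γ) (Icc 0 1) t
    set b := derivWithin (velocity η) (Icc 0 1) t
    have e1 := h.abs_inner_le_of_mem_normalSpace (hγ.1.2.1 ht') (hγx t ht') (hη.1.2.1 ht')
      (hηx t ht') (hγ.1.2.2 t ht')
    have e2 := h.abs_inner_le_of_mem_normalSpace (hη.1.2.1 ht') (hηx t ht') (hγ.1.2.1 ht')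
      (hγx t ht') (hη.1.2.2 t ht')
    have a1 := hγ.1.norm_derivWithin_velocity_le h hγx ht'
    have a2 := hη.1.norm_derivWithin_velocity_le h hηx ht'
    rw [hd] at a2
    rw [norm_sub_rev (γ t)] at e2
    have b1 : Λ * ‖a‖ * ‖η t - γ t‖ ^ 2 ≤ 1 / 4 * ‖η t - γ t‖ ^ 2 := by
      gcongr
      calc (Λ : ℝ) * ‖a‖ ≤ Λ * (Λ * ‖velocity γ 0‖ ^ 2) := by gcongr
        _ = (Λ * ‖velocity γ 0‖) ^ 2 := by ring
        _ ≤ _ := hsq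
    have b2 : Λ * ‖b‖ * ‖η t - γ t‖ ^ 2 ≤ 1 / 4 * ‖η t - γ t‖ ^ 2 := by
      gcongr
      calc (Λ : ℝ) * ‖b‖ ≤ Λ * (Λ * ‖velocity γ 0‖ ^ 2) := by gcongr
        _ = (Λ * ‖velocity γ 0‖) ^ 2 := by ring
        _ ≤ _ := hsq
    have e3 : ⟪η t - γ t, b - a⟫ = -⟪b, γ t - η t⟫ - ⟪a, η t - γ t⟫ := by
      rw [← neg_sub (η t) (γ t), inner_neg_right, neg_neg, inner_sub_right,
        real_inner_comm b, real_inner_comm a]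
    have e4 : 0 ≤ ⟪velocity η t - velocity γ t, velocity η t - velocity γ t⟫ :=
      real_inner_self_nonneg
    rw [e3]
    linarith [(abs_le.1 e1).2, (abs_le.1 e2).2]

/-- `‖γ - x‖²` is convex: the acceleration term in its second derivative is at most `Λ ρ` times the
squared speed, and the squared speed absorbs it. -/
theorem mapsTo_ball_of_isMinimizingGeodesic (h : IsLocalRetraction M x R ρ K Λ)
    (hr : (2 * K + 1) * r ≤ ρ / 2) (hyM : y ∈ M)
    (hy : y ∈ Metric.ball x r) (hzM : z ∈ M) (hz : z ∈ Metric.ball x r)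
    (hγ : IsMinimizingGeodesic M γ y z) : MapsTo γ (Icc 0 1) (Metric.ball x r) := by
  have hγx := h.mem_ball_of_isMinimizingGeodesic hr hyM hy hzM hz hγ
  have hconv : ConvexOn ℝ (Icc (0 : ℝ) 1) fun t => ‖γ t - x‖ ^ 2 := by
    refine convexOn_of_hasDerivWithinAt2_nonneg (convex_Icc 0 1)
      (f' := fun t => 2 * ⟪γ t - x, velocity γ t⟫)
      (f'' := fun t => 2 * (⟪γ t - x, derivWithin (velocity γ) (Icc 0 1) t⟫ +
        ⟪velocity γ t, velocity γ t⟫))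
      ((hγ.1.continuousOn.sub continuousOn_const).norm.pow 2) ?_ ?_ ?_ <;>
      rw [interior_Icc] <;> intro t ht
    · exact ((hγ.1.hasDerivAt ht).sub_const x).norm_sq.hasDerivWithinAt
    · exact ((((hγ.1.hasDerivAt ht).sub_const x).inner ℝ
        (hγ.1.hasDerivAt_velocity ht)).const_mul 2).hasDerivWithinAt
    · have ht' := Ioo_subset_Icc_self ht
      have h1 := hγ.1.norm_derivWithin_velocity_le h hγx ht'
      have h2 := hγx t ht'
      rw [mem_ball_iff_norm] at h2
      have hρ := h.pos.le
      have h3 : |⟪γ t - x, derivWithin (velocity γ) (Icc 0 1) t⟫| ≤ ‖velocity γ 0‖ ^ 2 := by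
        calc _ ≤ ‖γ t - x‖ * ‖derivWithin (velocity γ) (Icc 0 1) t‖ := abs_real_inner_le_norm _ _
          _ ≤ ρ * (Λ * ‖velocity γ 0‖ ^ 2) := by gcongr
          _ = (Λ * ρ) * ‖velocity γ 0‖ ^ 2 := by ring
          _ ≤ 1 * ‖velocity γ 0‖ ^ 2 := by gcongr; linarith [h.mul_le_half]
          _ = _ := one_mul _
      rw [real_inner_self_eq_norm_sq, hγ.1.norm_velocity_eq ht']
      linarith [(abs_le.1 h3).1]
  intro t ht
  rw [mem_ball_iff_norm] at hy hz ⊢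
  have h1 := hconv.le_max_of_mem_Icc (left_mem_Icc.2 zero_le_one) (right_mem_Icc.2 zero_le_one) ht
  simp only [hγ.2.1, hγ.2.2.1] at h1
  have hr0 : 0 ≤ r := (norm_nonneg _).trans hy.le
  refine lt_of_pow_lt_pow_left₀ 2 hr0 (h1.trans_lt (max_lt ?_ ?_))
  · exact pow_lt_pow_left₀ hy (norm_nonneg _) two_ne_zero
  · exact pow_lt_pow_left₀ hz (norm_nonneg _) two_ne_zero

/-- Small Euclidean balls intersect `M` in geodesically convex sets. -/
theorem isGeodesicallyConvex (h : IsLocalRetraction M x R ρ K Λ) (hr : (2 * K + 1) * r ≤ ρ / 2) :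
    IsGeodesicallyConvex M (M ∩ Metric.ball x r) := by
  refine ⟨inter_subset_left, fun y hy z hz => ?_⟩
  obtain ⟨γ, hγ⟩ := h.exists_isMinimizingGeodesic hr hy.1 hy.2 hz.1 hz.2
  exact ⟨γ, hγ, fun t ht => ⟨hγ.1.2.1 ht,
      h.mapsTo_ball_of_isMinimizingGeodesic hr hy.1 hy.2 hz.1 hz.2 hγ ht⟩,
    fun η hη => h.eqOn_of_isMinimizingGeodesic hr hy.1 hy.2 hz.1 hz.2 hγ hη⟩

end IsLocalRetraction

end Convexity

/-! ### Comparison of the two proximal normal cones -/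

section NormalCones

variable {n : ℕ} {M S : Set (EuclideanSpace ℝ (Fin n))}
  {x y : EuclideanSpace ℝ (Fin n)} {ρ r : ℝ} {K Λ : ℝ≥0}
  {R : EuclideanSpace ℝ (Fin n) → EuclideanSpace ℝ (Fin n)}
  {γ : ℝ → EuclideanSpace ℝ (Fin n)}

namespace IsLocalRetraction

theorem exists_pos_radius (h : IsLocalRetraction M x R ρ K Λ)
    {s : Set (EuclideanSpace ℝ (Fin n))} (hs : s ∈ 𝓝 x) :
    ∃ r, 0 < r ∧ (2 * K + 1) * r ≤ ρ / 2 ∧ Metric.ball x r ⊆ s := by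
  obtain ⟨δ, hδ, hδs⟩ := Metric.mem_nhds_iff.1 hs
  have hρ := h.pos
  refine ⟨min δ (ρ / 2 / (2 * K + 1)), lt_min hδ (by positivity), ?_,
    (Metric.ball_subset_ball (min_le_left _ _)).trans hδs⟩
  calc (2 * K + 1) * min δ (ρ / 2 / (2 * K + 1)) ≤ (2 * K + 1) * (ρ / 2 / (2 * (K : ℝ) + 1)) := by
        gcongr; exact min_le_right _ _
    _ = ρ / 2 := by field_simp

/-- A minimizing geodesic is at least as long as its chord; its existence also makes `riemDist`
finite, so that `toReal` does not collapse `∞` to `0`. -/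
theorem dist_le_riemDist (h : IsLocalRetraction M x R ρ K Λ)
    (hr : (2 * K + 1) * r ≤ ρ / 2) (hr0 : 0 < r) (hx : x ∈ M) (hyM : y ∈ M)
    (hy : y ∈ Metric.ball x r) : ‖y - x‖ ≤ (riemDist M x y).toReal := by
  have hxr : x ∈ Metric.ball x r := Metric.mem_ball_self hr0
  obtain ⟨γ, hγ⟩ := h.exists_isMinimizingGeodesic hr hx hxr hyM hy
  have := hγ.1.norm_sub_le (right_mem_Icc.2 zero_le_one)
  rwa [hγ.2.1, hγ.2.2.1, hγ.norm_velocity] at this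

theorem riemDist_toReal_le (h : IsLocalRetraction M x R ρ K Λ)
    (hr : (2 * K + 1) * r ≤ ρ / 2) (hx : x ∈ M) (hyM : y ∈ M)
    (hy : y ∈ Metric.ball x r) : (riemDist M x y).toReal ≤ K * ‖y - x‖ :=
  ENNReal.toReal_le_of_le_ofReal (by positivity)
    (h.riemDist_le hx (Metric.mem_closedBall_self h.pos.le) hyM (h.ball_subset_closedBall hr hy))

/-- The inverse of the exponential map agrees with the Euclidean difference up to second order. -/
theorem norm_sub_expInv_le (h : IsLocalRetraction M x R ρ K Λ)
    (hr : (2 * K + 1) * r ≤ ρ / 2) (hr0 : 0 < r) (hx : x ∈ M) (hyM : y ∈ M)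
    (hy : y ∈ Metric.ball x r) {v : EuclideanSpace ℝ (Fin n)} (hv : IsExpInv M x y v) :
    ‖y - x - v‖ ≤ Λ * (riemDist M x y).toReal ^ 2 := by
  obtain ⟨γ, hγ, rfl⟩ := hv
  have := hγ.1.norm_sub_sub_velocity_le h
    (h.mem_ball_of_isMinimizingGeodesic hr hx (Metric.mem_ball_self hr0) hyM hy hγ)
  rwa [hγ.2.1, hγ.2.2.1, hγ.norm_velocity] at this

theorem abs_inner_normal_le (h : IsLocalRetraction M x R ρ K Λ)
    (hr : (2 * K + 1) * r ≤ ρ / 2) (hx : x ∈ M) (hyM : y ∈ M)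
    (hy : y ∈ Metric.ball x r) {w : EuclideanSpace ℝ (Fin n)} (hw : w ∈ normalSpace M x) :
    |⟪w, y - x⟫| ≤ Λ * ‖w‖ * ‖y - x‖ ^ 2 := by
  refine h.abs_inner_le_of_mem_normalSpace hx (Metric.mem_ball_self h.pos) hyM ?_ hw
  refine Metric.ball_subset_ball ?_ hy
  have hK : (0 : ℝ) ≤ K := K.2
  have := h.pos
  by_contra hlt
  nlinarith

theorem euclideanProximalNormalCone_subset (h : IsLocalRetraction M x R ρ K Λ) (hx : x ∈ M) :
    euclideanProximalNormalCone S x ⊆ proximalNormalCone M S x +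
      (normalSpace M x : Set (EuclideanSpace ℝ (Fin n))) := by
  rintro ξ ⟨σ, hσ, U, -, hU, hξ⟩
  obtain ⟨r, hr0, hr, hrU⟩ := h.exists_pos_radius hU
  set v := (tangentSpace M x).starProjection ξ with hv
  have hw : ξ - v ∈ normalSpace M x := Submodule.sub_starProjection_mem_orthogonal ξ
  refine mem_add.2 ⟨v, ⟨Submodule.starProjection_apply_mem _ _,
    -- The summands pay, in order, for the three terms of `⟪v, e⟫ = ⟪ξ, y - x⟫ - ⟪ξ - v, y - x⟫ -
    -- ⟪v, y - x - e⟫`.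
    σ + Λ * ‖ξ - v‖ + ‖v‖ * Λ, by positivity, M ∩ Metric.ball x r, h.isGeodesicallyConvex hr,
    inter_mem self_mem_nhdsWithin (mem_nhdsWithin_of_mem_nhds (Metric.ball_mem_nhds x hr0)),
    ?_⟩, ξ - v, hw, by abel⟩
  rintro y ⟨⟨hyM, hyr⟩, hyS⟩ e he
  set d := (riemDist M x y).toReal
  have h1 := hξ y ⟨hrU hyr, hyS⟩
  rw [dist_comm, dist_eq_norm] at h1
  have h2 := h.abs_inner_normal_le hr hx hyM hyr hw
  have h3 := h.norm_sub_expInv_le hr hr0 hx hyM hyr he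
  have h4 : ‖y - x‖ ^ 2 ≤ d ^ 2 :=
    pow_le_pow_left₀ (norm_nonneg _) (h.dist_le_riemDist hr hr0 hx hyM hyr) 2
  have h5 : |⟪v, y - x - e⟫| ≤ ‖v‖ * (Λ * d ^ 2) :=
    (abs_real_inner_le_norm _ _).trans (by gcongr)
  have h6 : ⟪v, e⟫ = ⟪ξ, y - x⟫ - ⟪ξ - v, y - x⟫ - ⟪v, y - x - e⟫ := by
    rw [inner_sub_left ξ v, inner_sub_right v (y - x) e]; ring
  have h7 : (σ + Λ * ‖ξ - v‖) * ‖y - x‖ ^ 2 ≤ (σ + Λ * ‖ξ - v‖) * d ^ 2 := by gcongr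
  rw [h6]
  linarith [(abs_le.1 h2).1, (abs_le.1 h5).1]

theorem subset_euclideanProximalNormalCone (h : IsLocalRetraction M x R ρ K Λ)
    (hx : x ∈ M) (hSM : S ⊆ M) :
    proximalNormalCone M S x + (normalSpace M x : Set (EuclideanSpace ℝ (Fin n))) ⊆
      euclideanProximalNormalCone S x := by
  rintro _ ⟨v, ⟨-, σ, hσ, U, hUc, hU, hv⟩, w, hw, rfl⟩
  obtain ⟨s, hs, hsU⟩ := mem_nhdsWithin_iff_exists_mem_nhds_inter.1 hU
  obtain ⟨r, hr0, hr, hrs⟩ := h.exists_pos_radius hs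
  -- `K ^ 2` converts `d ^ 2` into `‖y - x‖ ^ 2`; the `+ 1` keeps the constant positive even for `K
  -- = Λ = 0`.
  refine ⟨(σ + ‖v‖ * Λ) * K ^ 2 + Λ * ‖w‖ + 1, by positivity, Metric.ball x r, convex_ball x r,
    Metric.ball_mem_nhds x hr0, ?_⟩
  rintro y ⟨hyr, hyS⟩
  have hyM := hSM hyS
  have hyU : y ∈ U := hsU ⟨hrs hyr, hyM⟩
  have hxU : x ∈ U := mem_of_mem_nhdsWithin hx hU
  -- The hypothesis on `v` speaks about every value of `exp_x⁻¹ y`; convexity of `U` supplies one.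
  obtain ⟨γ, hγ, -⟩ := hUc.2 x hxU y hyU
  have he : IsExpInv M x y (velocity γ 0) := ⟨γ, hγ, rfl⟩
  set e := velocity γ 0
  set d := (riemDist M x y).toReal
  have h1 := hv y ⟨hyU, hyS⟩ e he
  have h2 := h.abs_inner_normal_le hr hx hyM hyr hw
  have h3 := h.norm_sub_expInv_le hr hr0 hx hyM hyr he
  have h4 : d ^ 2 ≤ (K * ‖y - x‖) ^ 2 :=
    pow_le_pow_left₀ ENNReal.toReal_nonneg (h.riemDist_toReal_le hr hx hyM hyr) 2
  have h5 : |⟪v, y - x - e⟫| ≤ ‖v‖ * (Λ * d ^ 2) :=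
    (abs_real_inner_le_norm _ _).trans (by gcongr)
  have h6 : ⟪v + w, y - x⟫ = ⟪v, e⟫ + ⟪v, y - x - e⟫ + ⟪w, y - x⟫ := by
    rw [inner_add_left, inner_sub_right v (y - x) e]; ring
  have h7 : (σ + ‖v‖ * Λ) * d ^ 2 ≤ (σ + ‖v‖ * Λ) * (K * ‖y - x‖) ^ 2 := by gcongr
  rw [dist_comm, dist_eq_norm]
  simp only
  rw [h6]
  nlinarith [(abs_le.1 h2).2, (abs_le.1 h5).2, sq_nonneg ‖y - x‖]

end IsLocalRetraction

theorem eq_and_eq_of_add_eq_add {v v' w w' : EuclideanSpace ℝ (Fin n)}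
    (hv : v ∈ tangentSpace M x) (hv' : v' ∈ tangentSpace M x) (hw : w ∈ normalSpace M x)
    (hw' : w' ∈ normalSpace M x) (h : v + w = v' + w') : v = v' ∧ w = w' := by
  have h1 : v - v' = w' - w := by
    rw [sub_eq_sub_iff_add_eq_add, h, add_comm]
  have h2 : v - v' ∈ normalSpace M x := h1 ▸ sub_mem hw' hw
  have h3 : v - v' = 0 := inner_self_eq_zero.1
    ((Submodule.mem_orthogonal _ _).1 h2 _ (sub_mem hv hv'))
  have h4 : v = v' := sub_eq_zero.1 h3
  subst h4
  exact ⟨rfl, add_left_cancel h⟩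

end NormalCones

end EmbeddedGeometry

theorem theorem4p2 (n m : ℕ) (M : Set (EuclideanSpace ℝ (Fin n)))
    (hM : EmbeddedGeometry.IsC2Submanifold m M)
    (hMc : EmbeddedGeometry.IsCompleteSubmanifold M)
    (S : Set (EuclideanSpace ℝ (Fin n))) (hSM : S ⊆ M)
    (hS : IsClosed (((↑) : M → EuclideanSpace ℝ (Fin n)) ⁻¹' S))
    (x : EuclideanSpace ℝ (Fin n)) (hx : x ∈ S) :
    EmbeddedGeometry.euclideanProximalNormalCone S x =
        EmbeddedGeometry.proximalNormalCone M S x +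
          (EmbeddedGeometry.normalSpace M x : Set (EuclideanSpace ℝ (Fin n))) ∧
      ∀ v ∈ EmbeddedGeometry.proximalNormalCone M S x,
        ∀ v' ∈ EmbeddedGeometry.proximalNormalCone M S x,
          ∀ w ∈ EmbeddedGeometry.normalSpace M x, ∀ w' ∈ EmbeddedGeometry.normalSpace M x,
            v + w = v' + w' → v = v' ∧ w = w' := by
  obtain ⟨R, ρ, K, Λ, h⟩ := hM.exists_isLocalRetraction (hSM hx)
  refine ⟨(h.euclideanProximalNormalCone_subset (hSM hx)).antisymm
    (h.subset_euclideanProximalNormalCone (hSM hx) hSM), fun v hv v' hv' w hw w' hw' hsum => ?_⟩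
  exact EmbeddedGeometry.eq_and_eq_of_add_eq_add hv.1 hv'.1 hw hw' hsum
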